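/- Notation. Let $\mathbb T_m(\mathbb R)$ be the set of real lower triangular $m\times m$ matrices with constant diagonal, let $\mathbb S=\left\{\begin{bmatrix}\alpha&\beta\\-\beta&\alpha\end{bmatrix}:\alpha,\beta\in\mathbb R\right\}$, and let $\mathbb B_m(\mathbb R)$ be the set of real $2m\times 2m$ matrices that are lower block triangular with $2\times2$ blocks in $\mathbb S$ and equal diagonal blocks. Let $r,s\ge 0$ be integers and let $\eta=(n_1,\dots,n_r;m_1,\dots,m_s)$ be positive integers with $(n_1+\dots+n_r)+2(m_1+\dots+m_s)=n$. Put $$\mathcal K_{\eta,r,s}=\mathbb T_{n_1}(\mathbb R)\oplus\dots\oplus\mathbb T_{n_r}(\mathbb R)\oplus\mathbb B_{m_1}(\mathbb R)\oplus\dots\oplus\mathbb B_{m_s}(\mathbb R)\subset M_n(\mathbb R),\qquad \mathcal K^*_{\eta,r,s}=\mathcal K_{\eta,r,s}\cap \mathrm{GL}(n,\mathbb R).$$ Let $u_0\in\mathbb R^n$ be the vector whose component in each of the $r+s$ blocks is $[1,0,\dots,0]^T$, and for $1\le l\le s$ let $f^{(l)}\in\mathbb R^n$ be the vector whose component in the block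 of size $2m_l$ is $[0,1,0,\dots,0]^T$ and whose other components are $0$. Let $G$ be an abelian subgroup of $\mathrm{GL}(n,\mathbb R)$ and $P\in\mathrm{GL}(n,\mathbb R)$ such that $P^{-1}GP\subset\mathcal K^*_{\eta,r,s}$, and put $v_0=Pu_0$. Put $\mathrm g=\{B\in P\mathcal K_{\eta,r,s}P^{-1}: e^B\in G\}$, $G^2=\{A^2:A\in G\}$, $\mathrm g^2=\{B\in P\mathcal K_{\eta,r,s}P^{-1}: e^B\in G^2\}$ and $\mathrm g^2_{v_0}=\{Bv_0: B\in \mathrm g^2\}$. For $M\in P^{-1}GP$ let $\mu_k(M)$ be the eigenvalue of its $k$-th diagonal block in $\mathbb T_{n_k}(\mathbb R)$, $1\le k\le r$, and let $\mathrm{ind}(G)$ be the number of $k\in\{1,\dots,r\}$ for which there is $M\in P^{-1}GP$ with $\mu_k(M)<0$ and $\mu_i(M)>0$ for all $i\ne k$. Matrices $C_1,\dots,C_p\in\mathcal K_{\eta,r,s}$ are said to satisfy the density property if there exist $D_1,\dots,D_p\in\mathcal K_{\eta,r,s}$ with $C_k^2=e^{D_k}$ for $1\le k\le p$ such that for every $(s_1,\dots,s_p;t_1,\dots,t_s)\in\mathbb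 Z^{p+s}\setminus\{0\}$ $$\mathrm{rank}\begin{bmatrix}D_1u_0&\cdots&D_pu_0&2\pi f^{(1)}&\cdots&2\pi f^{(s)}\\ s_1&\cdots&s_p&t_1&\cdots&t_s\end{bmatrix}=n+1 .$$ Corollary 1.5. Suppose that $A_1,\dots,A_p$ generate $G$, and let $B_1,\dots,B_p\in\mathrm g$ satisfy $A_k^2=e^{B_k}$ for $1\le k\le p$. Then $$\mathrm g^2_{v_0}=\sum_{k=1}^p\mathbb Z\,B_kv_0+\sum_{l=1}^s2\pi\mathbb Z\,Pf^{(l)},$$ and the following properties are equivalent: (i) $G$ is topologically transitive, i.e. some orbit $G(v)=\{Av:A\in G\}$, $v\in\mathbb R^n$, is dense in $\mathbb R^n$; (ii) $P^{-1}A_1P,\dots,P^{-1}A_pP$ satisfy the density property and $\mathrm{ind}(G)=r$; (iii) $\sum_{k=1}^p\mathbb Z\,B_kv_0+\sum_{l=1}^s2\pi\mathbb Z\,Pf^{(l)}$ is dense in $\mathbb R^n$ and $\mathrm{ind}(G)=r$. -/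

import Mathlib

open scoped Matrix BigOperators MatrixGroups

noncomputable section

namespace AbelianLinear

/-- The partition data `η = (n₁, …, n_r; m₁, …, m_s)` of `n`: positive integers with
`(n₁ + ⋯ + n_r) + 2 (m₁ + ⋯ + m_s) = n`.  Either of `r`, `s` may be `0`. -/
structure BlockType (n : ℕ) where
  r : ℕ
  s : ℕ
  nn : Fin r → ℕ
  mm : Fin s → ℕ
  nn_pos : ∀ k, 0 < nn k
  mm_pos : ∀ l, 0 < mm l
  sum_eq : (∑ k, nn k) + 2 * (∑ l, mm l) = n

/-- `𝕋_m(ℝ)`: lower triangular real matrices of order `m` with constant diagonal. -/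
def TMat (m : ℕ) : Set (Matrix (Fin m) (Fin m) ℝ) :=
  {A | (∃ μ : ℝ, ∀ i, A i i = μ) ∧ ∀ i j, i < j → A i j = 0}

/-- `𝕊`: the real `2 × 2` matrices `[α, β; -β, α]`. -/
def SMat : Set (Matrix (Fin 2) (Fin 2) ℝ) :=
  {C | ∃ α β : ℝ, C = !![α, β; -β, α]}

/-- The `2 × 2` block in position `(i, j)` of a matrix of order `2m`. -/
def block2 {m : ℕ} (A : Matrix (Fin m × Fin 2) (Fin m × Fin 2) ℝ) (i j : Fin m) :
    Matrix (Fin 2) (Fin 2) ℝ :=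
  Matrix.of fun a b => A (i, a) (j, b)

/-- `𝔹_m(ℝ)`: lower block triangular matrices with `2 × 2` blocks in `𝕊` and constant
diagonal block.  The index `(i, a)` is the coordinate number `2 i + a`, counted from `0`. -/
def BMat (m : ℕ) : Set (Matrix (Fin m × Fin 2) (Fin m × Fin 2) ℝ) :=
  {A | (∀ i j, block2 A i j ∈ SMat) ∧ (∃ C, ∀ i, block2 A i i = C) ∧
    ∀ i j, i < j → block2 A i j = 0}

namespace BlockType

variable {n : ℕ} (η : BlockType n)

/-- Coordinates of `ℝⁿ = ℝ^{n₁} × ⋯ × ℝ^{n_r} × ℝ^{2m₁} × ⋯ × ℝ^{2m_s}`, listed by blocks. -/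
abbrev Idx : Type :=
  (Σ k : Fin η.r, Fin (η.nn k)) ⊕ (Σ l : Fin η.s, Fin (η.mm l) × Fin 2)

/-- The order-preserving numbering of the block coordinates by `Fin n`: first the blocks of
sizes `n₁, …, n_r`, then those of sizes `2m₁, …, 2m_s`. -/
def coord : η.Idx ≃ Fin n :=
  (Equiv.sumCongr finSigmaFinEquiv
    ((Equiv.sigmaCongrRight fun l => finProdFinEquiv (m := η.mm l) (n := 2)).trans
      finSigmaFinEquiv)).trans <|
  finSumFinEquiv.trans <|
  finCongr (by rw [← Finset.sum_mul, mul_comm, η.sum_eq])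

/-- `𝒦_{η,r,s}(ℝ) = 𝕋_{n₁}(ℝ) ⊕ ⋯ ⊕ 𝕋_{n_r}(ℝ) ⊕ 𝔹_{m₁}(ℝ) ⊕ ⋯ ⊕ 𝔹_{m_s}(ℝ)`. -/
def K : Set (Matrix (Fin n) (Fin n) ℝ) :=
  {M | ∃ (A : ∀ k : Fin η.r, Matrix (Fin (η.nn k)) (Fin (η.nn k)) ℝ)
      (B : ∀ l : Fin η.s, Matrix (Fin (η.mm l) × Fin 2) (Fin (η.mm l) × Fin 2) ℝ),
      (∀ k, A k ∈ TMat (η.nn k)) ∧ (∀ l, B l ∈ BMat (η.mm l)) ∧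
      M = Matrix.reindex η.coord η.coord
        (Matrix.fromBlocks (Matrix.blockDiagonal' A) 0 0 (Matrix.blockDiagonal' B))}

/-- `u₀`: the vector whose component in every block is `[1, 0, …, 0]ᵀ`. -/
def u₀ : Fin n → ℝ := fun i =>
  Sum.elim (fun x => if (x.2 : ℕ) = 0 then (1 : ℝ) else 0)
    (fun x => if (x.2.1 : ℕ) = 0 ∧ x.2.2 = 0 then (1 : ℝ) else 0) (η.coord.symm i)

/-- `f⁽ˡ⁾`: the vector whose component in the block of size `2 m_l` is `[0, 1, 0, …, 0]ᵀ`, all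
other components being zero. -/
def f (l : Fin η.s) : Fin n → ℝ :=
  Pi.single (η.coord (Sum.inr ⟨l, (⟨0, η.mm_pos l⟩, 1)⟩)) 1

/-- The coordinate number of the first coordinate of the `k`-th triangular block. -/
def firstCoord (k : Fin η.r) : Fin n := η.coord (Sum.inl ⟨k, ⟨0, η.nn_pos k⟩⟩)

/-- For `M ∈ 𝒦_{η,r,s}(ℝ)`, the unique eigenvalue `μ_k` of the block `M_k ∈ 𝕋_{n_k}(ℝ)`, that is,
its constant diagonal entry. -/
def eigen (M : Matrix (Fin n) (Fin n) ℝ) (k : Fin η.r) : ℝ :=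
  M (η.firstCoord k) (η.firstCoord k)

/-- The index of a subgroup of `𝒦*_{η,r,s}(ℝ)`: the number of `k ∈ {1, …, r}` such that some
element has `μ_k < 0` and `μ_i > 0` for all `i ≠ k`.  For `r = 0` this is `0`, and for `r = 1` it is
`1` or `0` according to whether or not some element has `μ₁ < 0`. -/
def ind (H : Subgroup (GL (Fin n) ℝ)) : ℕ :=
  {k : Fin η.r | ∃ M ∈ H, η.eigen (M : Matrix (Fin n) (Fin n) ℝ) k < 0 ∧
    ∀ i, i ≠ k → 0 < η.eigen (M : Matrix (Fin n) (Fin n) ℝ) i}.ncard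

/-- `exp⁻¹(S) ∩ P 𝒦_{η,r,s}(ℝ) P⁻¹`.  For `S = G` this is `g`, for `S = G²` it is `g²`. -/
def logSet (P : GL (Fin n) ℝ) (S : Set (GL (Fin n) ℝ)) : Set (Matrix (Fin n) (Fin n) ℝ) :=
  {B | (∃ M ∈ S, NormedSpace.exp B = (M : Matrix (Fin n) (Fin n) ℝ)) ∧
    ∃ C ∈ η.K, B = (P : Matrix (Fin n) (Fin n) ℝ) * C * ((P⁻¹ : GL (Fin n) ℝ) :
      Matrix (Fin n) (Fin n) ℝ)}

/-- The density property of `A₁, …, A_p ∈ 𝒦_{η,r,s}(ℝ)`: there are `B₁, …, B_p ∈ 𝒦_{η,r,s}(ℝ)` with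
`A_k² = exp B_k` such that for all integers `(s₁, …, s_p; t₁, …, t_s) ≠ 0` the matrix with columns
`(B_k u₀, s_k)` and `(2π f⁽ˡ⁾, t_l)` has rank `n + 1`. -/
def DensityProperty {p : ℕ} (A : Fin p → Matrix (Fin n) (Fin n) ℝ) : Prop :=
  ∃ B : Fin p → Matrix (Fin n) (Fin n) ℝ,
    (∀ k, B k ∈ η.K) ∧ (∀ k, A k ^ 2 = NormedSpace.exp (B k)) ∧
    ∀ (σ : Fin p → ℤ) (t : Fin η.s → ℤ), (σ, t) ≠ 0 →
      (Matrix.fromBlocks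
        (Matrix.of fun (i : Fin n) (k : Fin p) => (B k *ᵥ η.u₀) i)
        (Matrix.of fun (i : Fin n) (l : Fin η.s) => 2 * Real.pi * η.f l i)
        (Matrix.of fun (_ : Unit) (k : Fin p) => (σ k : ℝ))
        (Matrix.of fun (_ : Unit) (l : Fin η.s) => (t l : ℝ))).rank = n + 1

/-- `v₀ = P u₀`. -/
def v₀ (P : GL (Fin n) ℝ) : Fin n → ℝ := (P : Matrix (Fin n) (Fin n) ℝ) *ᵥ η.u₀

/-- `∑_k ℤ (B_k v₀) + ∑_l 2π ℤ P f⁽ˡ⁾`. -/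
def lattice (P : GL (Fin n) ℝ) {p : ℕ} (B : Fin p → Matrix (Fin n) (Fin n) ℝ) :
    Set (Fin n → ℝ) :=
  {x | ∃ (a : Fin p → ℤ) (b : Fin η.s → ℤ),
    x = ∑ k, (a k : ℝ) • (B k *ᵥ η.v₀ P) +
      ∑ l, (2 * Real.pi * (b l : ℝ)) • ((P : Matrix (Fin n) (Fin n) ℝ) *ᵥ η.f l)}

end BlockType

/-- The conjugate subgroup `P⁻¹ G P`. -/
def conjInv {n : ℕ} (P : GL (Fin n) ℝ) (G : Subgroup (GL (Fin n) ℝ)) :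
    Subgroup (GL (Fin n) ℝ) :=
  G.map (MulAut.conj P⁻¹).toMonoidHom

/-- `G²`, the set of squares of the elements of `G`. -/
def squares {n : ℕ} (G : Subgroup (GL (Fin n) ℝ)) : Set (GL (Fin n) ℝ) :=
  (fun A => A ^ 2) '' (G : Set (GL (Fin n) ℝ))

/-- The orbit `G(v) = {A v : A ∈ G}`. -/
def orbit {n : ℕ} (G : Subgroup (GL (Fin n) ℝ)) (v : Fin n → ℝ) : Set (Fin n → ℝ) :=
  {w | ∃ A ∈ G, w = (A : Matrix (Fin n) (Fin n) ℝ) *ᵥ v}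

/-- `G` is topologically transitive: it has a dense orbit in `ℝⁿ`. -/
def TopTransitive {n : ℕ} (G : Subgroup (GL (Fin n) ℝ)) : Prop :=
  ∃ v : Fin n → ℝ, Dense (orbit G v)

end AbelianLinear

end

/-! ### Exponential and logarithm of nilpotents in a ℚ-algebra. -/

section NilpotentLog

variable {A : Type*} [Ring A] [Algebra ℚ A]

/-! Conjugation by `P` reduces everything to `P = 1`. The algebra `K` is a product of local algebras
over ℝ or ℂ (modelled by `Alg`), in which each element is a central block scalar plus a nilpotent.
Hence the exponential behaves almost as on numbers: what commutes with exp x commutes with x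
(`commute_of_commute_expAlg`); exp x = exp y exactly when x and y differ by multiples of 2πi in the
complex blocks (`expAlg_eq_iff`); an element with positive real and nonzero complex eigenvalues has
a logarithm (`exists_expAlg_eq`). The logarithms of squares of `G` therefore commute and form an
additive group `sqLog`, generated by logarithms of the squared generators together with the periods
(`mem_sqLog_iff`). Applied to `u₀`, the periods become the vectors 2πf⁽ˡ⁾, which gives the formula
for g².

For transitivity, let S be a commutative space of matrices with S u₀ = ℝⁿ. Then X ↦ X u₀ is a linear
isomorphism on S; with inverse ψ, put E(w) = exp(ψ w) u₀. If the logarithms are dense at `u₀`, take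
for S their span: by continuity of E the orbit of `u₀` is dense among vectors with positive real
heads, and the sign-changing elements supplied by maximal index carry this to all of ℝⁿ. Conversely,
a dense orbit can be transported to `u₀`, where the signs are visible in the first coordinates. With
S the span of `G`, the map E is open, so approximating E v by vectors M² u₀ approximates v itself by
logarithms (`dense_sqLogOrbit_of_dense_orbit`).

The rank condition is Kronecker's theorem: a subgroup of ℝⁿ is dense iff no nonzero linear form is
integral on it (`AddSubgroup.dense_iff_forall_integral_dual`), and such forms are the left null
vectors of the bordered matrices. -/

theorem IsNilpotent.exists_exp_eq_one_add_add {n : A} (hn : IsNilpotent n) :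
    ∃ q ∈ Algebra.adjoin ℚ {n}, IsNilpotent.exp n = 1 + n + n ^ 2 * q := by
  obtain ⟨k, hk⟩ := hn
  have hk' : n ^ (k + 2) = 0 := by rw [pow_add, hk, zero_mul]
  refine ⟨∑ i ∈ Finset.range k, ((i + 2).factorial : ℚ)⁻¹ • n ^ i, ?_, ?_⟩
  · exact sum_mem fun i _ => Subalgebra.smul_mem _
      (pow_mem (Algebra.self_mem_adjoin_singleton ℚ n) i) _
  · rw [IsNilpotent.exp_eq_sum hk', Finset.sum_range_succ', Finset.sum_range_succ', Finset.mul_sum]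
    simp only [mul_smul_comm, ← pow_add]
    simp only [zero_add, Nat.factorial_one, Nat.cast_one, inv_one, pow_one, one_smul,
      Nat.factorial_zero, pow_zero, add_comm 2, add_assoc, Nat.reduceAdd]
    abel

theorem Algebra.commute_of_mem_adjoin_singleton {n q z : A} (hq : q ∈ Algebra.adjoin ℚ {n})
    (hz : Commute z n) : Commute z q := by
  have : Algebra.adjoin ℚ {n} ≤ Subalgebra.centralizer ℚ {z} := by
    rw [Algebra.adjoin_le_iff]
    rintro _ rfl
    simpa [Set.mem_centralizer_iff] using hz.eq
  exact (Subalgebra.mem_centralizer_iff ℚ).1 (this hq) z rfl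

/-- The expansion reads n (1 + n q) = 0, and 1 + n q is a unit. -/
theorem IsNilpotent.eq_zero_of_exp_eq_one {n : A} (hn : IsNilpotent n)
    (h : IsNilpotent.exp n = 1) : n = 0 := by
  obtain ⟨q, hq, he⟩ := hn.exists_exp_eq_one_add_add
  have hc : Commute n q := Algebra.commute_of_mem_adjoin_singleton hq (Commute.refl n)
  have hu : IsUnit (1 + n * q) := (hc.isNilpotent_mul_right hn).isUnit_one_add
  have : n * (1 + n * q) = 0 := by
    rw [h, add_assoc, left_eq_add] at he
    rw [mul_add, mul_one, ← mul_assoc, ← sq, he]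
  exact hu.mul_left_eq_zero.1 this

/-- Newton-like induction on the nilpotency order: (1 + M) exp(-M) = 1 + M² Q, whose nilpotent part
has smaller order. If L is its logarithm, L + M is one for 1 + M. Keeping L in the algebra generated
by M supplies the commutation needed to add. -/
theorem IsNilpotent.exists_exp_eq_one_add {M : A} (hM : IsNilpotent M) :
    ∃ L ∈ Algebra.adjoin ℚ {M}, IsNilpotent L ∧ IsNilpotent.exp L = 1 + M := by
  obtain ⟨k, hk⟩ := hM
  induction k using Nat.strong_induction_on generalizing M with
  | _ k ih =>
  have hM : IsNilpotent M := ⟨k, hk⟩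
  rcases Nat.lt_or_ge k 2 with hk2 | hk2
  · have h1 : M = 0 := by
      have := pow_eq_zero_of_le (show k ≤ 1 by omega) hk
      simpa using this
    exact ⟨0, zero_mem _, IsNilpotent.zero, by simp [h1]⟩
  · obtain ⟨q, hq, he⟩ := hM.neg.exists_exp_eq_one_add_add
    have hMm : M ∈ Algebra.adjoin ℚ {M} := Algebra.self_mem_adjoin_singleton ℚ M
    have hq' : q ∈ Algebra.adjoin ℚ {M} := by
      refine (Algebra.adjoin_le ?_ : Algebra.adjoin ℚ {-M} ≤ _) hq
      rintro _ rfl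
      exact neg_mem hMm
    set Q := (1 + M) * q - 1 with hQ
    have hQm : Q ∈ Algebra.adjoin ℚ {M} :=
      sub_mem (mul_mem (add_mem (one_mem _) hMm) hq') (one_mem _)
    have hMq : Commute M q := Algebra.commute_of_mem_adjoin_singleton hq' (Commute.refl M)
    have hMQ : Commute M Q := Algebra.commute_of_mem_adjoin_singleton hQm (Commute.refl M)
    have hprod : (1 + M) * IsNilpotent.exp (-M) = 1 + M ^ 2 * Q := by
      rw [he, hQ]; noncomm_ring
    have hnil : (M ^ 2 * Q) ^ (k - 1) = 0 := by
      rw [(hMQ.pow_left 2).mul_pow, ← pow_mul,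
        pow_eq_zero_of_le (show k ≤ 2 * (k - 1) by omega) hk, zero_mul]
    obtain ⟨L, hL, hLn, hLe⟩ := ih (k - 1) (by omega) hnil
    have hLm : L ∈ Algebra.adjoin ℚ {M} := by
      refine (Algebra.adjoin_le ?_ : Algebra.adjoin ℚ {M ^ 2 * Q} ≤ _) hL
      rintro _ rfl
      exact mul_mem (pow_mem hMm 2) hQm
    have hcL : Commute M L := Algebra.commute_of_mem_adjoin_singleton hLm (Commute.refl M)
    refine ⟨L + M, add_mem hLm hMm, hcL.symm.isNilpotent_add hLn hM, ?_⟩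
    rw [IsNilpotent.exp_add_of_commute hcL.symm hLn hM, hLe, ← hprod, mul_assoc,
      IsNilpotent.exp_neg_mul_exp_self hM, mul_one]

/-- The logarithm just constructed is a polynomial in exp n - 1, and it must be n, since the
difference is nilpotent with exponential 1. -/
theorem IsNilpotent.mem_adjoin_exp_sub_one {n : A} (hn : IsNilpotent n) :
    n ∈ Algebra.adjoin ℚ {IsNilpotent.exp n - 1} := by
  obtain ⟨L, hL, hLn, hLe⟩ := hn.isNilpotent_exp_sub_one.exists_exp_eq_one_add
  have hnL : Commute n L := by
    refine Algebra.commute_of_mem_adjoin_singleton hL ?_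
    obtain ⟨q, hq, he⟩ := hn.exists_exp_eq_one_add_add
    have hc : Commute n q := Algebra.commute_of_mem_adjoin_singleton hq (Commute.refl n)
    rw [he]
    refine Commute.sub_right (Commute.add_right (Commute.add_right (Commute.one_right _)
      (Commute.refl n)) (Commute.mul_right ((Commute.refl n).pow_right 2) hc)) (Commute.one_right _)
  have hLe' : IsNilpotent.exp L = IsNilpotent.exp n := by rw [hLe]; abel
  have h1 : IsNilpotent.exp (n + -L) = 1 := by
    rw [IsNilpotent.exp_add_of_commute hnL.neg_right hn hLn.neg, ← hLe',
      IsNilpotent.exp_mul_exp_neg_self hLn]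
  have h2 : IsNilpotent (n + -L) := hnL.neg_right.isNilpotent_add hn hLn.neg
  have h3 := h2.eq_zero_of_exp_eq_one h1
  rw [add_neg_eq_zero] at h3
  rwa [← h3] at hL

theorem IsNilpotent.commute_of_commute_exp {n z : A} (hn : IsNilpotent n)
    (h : Commute z (IsNilpotent.exp n)) : Commute z n :=
  Algebra.commute_of_mem_adjoin_singleton hn.mem_adjoin_exp_sub_one
    (h.sub_right (Commute.one_right z))

/-- No commutation is assumed: b commutes with exp b = exp a, hence with a. -/
theorem IsNilpotent.eq_of_exp_eq {a b : A} (ha : IsNilpotent a) (hb : IsNilpotent b)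
    (h : IsNilpotent.exp a = IsNilpotent.exp b) : a = b := by
  have hab : Commute b a := by
    refine ha.commute_of_commute_exp ?_
    rw [h]
    obtain ⟨q, hq, he⟩ := hb.exists_exp_eq_one_add_add
    have hc : Commute b q := Algebra.commute_of_mem_adjoin_singleton hq (Commute.refl b)
    rw [he]
    exact Commute.add_right (Commute.add_right (Commute.one_right _)
      (Commute.refl b)) (Commute.mul_right ((Commute.refl b).pow_right 2) hc)
  have h1 : IsNilpotent.exp (a + -b) = 1 := by
    rw [IsNilpotent.exp_add_of_commute hab.symm.neg_right ha hb.neg, h,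
      IsNilpotent.exp_mul_exp_neg_self hb]
  have h3 := (hab.symm.neg_right.isNilpotent_add ha hb.neg).eq_zero_of_exp_eq_one h1
  rw [eq_neg_of_add_eq_zero_left h3, neg_neg]

end NilpotentLog

/-! ### The algebra `K` as a product of local real and complex algebras. -/

noncomputable section

namespace AbelianLinear

/-- Lower triangular matrices with constant diagonal, over an arbitrary commutative ring. -/
def lowerConst (R : Type*) [CommRing R] (m : ℕ) : Subalgebra R (Matrix (Fin m) (Fin m) R) where
  carrier := {A | (∃ μ : R, ∀ i, A i i = μ) ∧ ∀ i j, i < j → A i j = 0}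
  mul_mem' := by
    rintro A B ⟨⟨a, ha⟩, hA⟩ ⟨⟨b, hb⟩, hB⟩
    refine ⟨⟨a * b, fun i => ?_⟩, fun i j hij => ?_⟩
    · rw [Matrix.mul_apply, Finset.sum_eq_single i, ha, hb]
      · intro l _ hl
        rcases lt_or_gt_of_ne hl with h | h
        · rw [hB _ _ h, mul_zero]
        · rw [hA _ _ h, zero_mul]
      · simp
    · rw [Matrix.mul_apply]
      refine Finset.sum_eq_zero fun l _ => ?_
      rcases lt_or_ge i l with h | h
      · rw [hA _ _ h, zero_mul]
      · rw [hB _ _ (lt_of_le_of_lt h hij), mul_zero]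
  add_mem' := by
    rintro A B ⟨⟨a, ha⟩, hA⟩ ⟨⟨b, hb⟩, hB⟩
    exact ⟨⟨a + b, fun i => by simp [ha, hb]⟩, fun i j hij => by simp [hA i j hij, hB i j hij]⟩
  algebraMap_mem' := fun r =>
    ⟨⟨r, fun i => by simp [Matrix.algebraMap_matrix_apply]⟩,
      fun i j hij => by simp [Matrix.algebraMap_matrix_apply, hij.ne]⟩

namespace lowerConst

variable {R : Type*} [CommRing R] {m : ℕ}

theorem apply_self (A : lowerConst R m) (i j : Fin m) : A.1 i i = A.1 j j := by
  obtain ⟨⟨μ, h⟩, -⟩ := A.2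
  rw [h, h]

/-- The diagonal value. -/
def diagVal (R : Type*) [CommRing R] {m : ℕ} (hm : 0 < m) : lowerConst R m →ₐ[R] R where
  toFun A := A.1 ⟨0, hm⟩ ⟨0, hm⟩
  map_one' := by simp
  map_zero' := by simp
  map_add' A B := by simp
  map_mul' A B := by
    simp only [Subalgebra.coe_mul, Matrix.mul_apply]
    rw [Finset.sum_eq_single (⟨0, hm⟩ : Fin m)]
    · intro l _ hl
      rw [A.2.2 ⟨0, hm⟩ l (Fin.lt_def.2 (Nat.pos_of_ne_zero fun h => hl (Fin.ext h))), zero_mul]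
    · simp
  commutes' r := by simp [Matrix.algebraMap_matrix_apply]

theorem diagVal_apply (hm : 0 < m) (A : lowerConst R m) :
    diagVal R hm A = A.1 ⟨0, hm⟩ ⟨0, hm⟩ := rfl

/-- Each strictly lower triangular factor pushes the support down by one more subdiagonal. -/
theorem pow_apply_of_diagVal_eq_zero (hm : 0 < m) (A : lowerConst R m) (hA : diagVal R hm A = 0)
    (k : ℕ) (i j : Fin m) (hij : (i : ℕ) < j + k) : (A.1 ^ k) i j = 0 := by
  induction k generalizing i j with
  | zero =>
    rw [pow_zero, Matrix.one_apply_ne]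
    rintro rfl
    omega
  | succ k ih =>
    rw [pow_succ, Matrix.mul_apply]
    refine Finset.sum_eq_zero fun l _ => ?_
    by_cases h : (i : ℕ) < l + k
    · rw [ih i l h, zero_mul]
    · have hlj : l ≤ j := by
        rw [Fin.le_def]; omega
      rcases hlj.lt_or_eq with h' | rfl
      · rw [A.2.2 _ _ h', mul_zero]
      · rw [apply_self A l ⟨0, hm⟩, ← diagVal_apply hm, hA, mul_zero]

theorem pow_eq_zero_of_diagVal_eq_zero (hm : 0 < m) (A : lowerConst R m)
    (hA : diagVal R hm A = 0) : A ^ m = 0 := by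
  ext i j
  exact pow_apply_of_diagVal_eq_zero hm A hA m i j (by have := i.2; omega)

end lowerConst

/-- Replacing each complex entry by the real `2 × 2` matrix of multiplication by it. -/
def realify (m : ℕ) : Matrix (Fin m) (Fin m) ℂ →ₐ[ℝ] Matrix (Fin m × Fin 2) (Fin m × Fin 2) ℝ :=
  (Matrix.compAlgEquiv (Fin m) (Fin 2) ℝ ℝ).toAlgHom.comp
    (Algebra.leftMulMatrix Complex.basisOneI).mapMatrix

theorem block2_realify {m : ℕ} (Z : Matrix (Fin m) (Fin m) ℂ) (i j : Fin m) :
    block2 (realify m Z) i j = !![(Z i j).re, -(Z i j).im; (Z i j).im, (Z i j).re] := by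
  rw [← Algebra.leftMulMatrix_complex]
  rfl

theorem realify_apply {m : ℕ} (Z : Matrix (Fin m) (Fin m) ℂ) (i j : Fin m) (a b : Fin 2) :
    realify m Z (i, a) (j, b) =
      !![(Z i j).re, -(Z i j).im; (Z i j).im, (Z i j).re] a b := by
  rw [← block2_realify]
  rfl

theorem block2_ext {m : ℕ} {A B : Matrix (Fin m × Fin 2) (Fin m × Fin 2) ℝ}
    (h : ∀ i j, block2 A i j = block2 B i j) : A = B := by
  ext ⟨i, a⟩ ⟨j, b⟩
  exact congrFun (congrFun (h i j) a) b

theorem mem_BMat_iff {m : ℕ} {B : Matrix (Fin m × Fin 2) (Fin m × Fin 2) ℝ} :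
    B ∈ BMat m ↔ ∃ Z ∈ lowerConst ℂ m, realify m Z = B := by
  constructor
  · rintro ⟨h1, ⟨C, h2⟩, h3⟩
    choose α β h using h1
    -- The sign is due to `realify` sending a + bi to [a, -b; b, a], whereas 𝕊 is written [α, β; -β,
    -- α].
    have hB : realify m (Matrix.of fun i j => (⟨α i j, -β i j⟩ : ℂ)) = B :=
      block2_ext fun i j => by rw [block2_realify, h i j]; simp
    refine ⟨_, ⟨⟨⟨C 0 0, -C 0 1⟩, fun i => ?_⟩, fun i j hij => ?_⟩, hB⟩
    · rw [← h2 i, h i i]; simp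
    · have h4 := h3 i j hij
      rw [h i j] at h4
      have h5 : α i j = 0 := by simpa using congrFun (congrFun h4 0) 0
      have h6 : β i j = 0 := by simpa using congrFun (congrFun h4 0) 1
      simp [h5, h6, Complex.ext_iff]
  · rintro ⟨Z, ⟨⟨μ, h1⟩, h2⟩, rfl⟩
    refine ⟨fun i j => ⟨(Z i j).re, -(Z i j).im, by rw [block2_realify, neg_neg]⟩,
      ⟨!![μ.re, -μ.im; μ.im, μ.re], fun i => by rw [block2_realify, h1]⟩, fun i j hij => ?_⟩
    rw [block2_realify, h2 i j hij]
    ext a b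
    fin_cases a <;> fin_cases b <;> simp

namespace BlockType

variable {n : ℕ} (η : BlockType n)

/-- `𝒦_{η,r,s}(ℝ)` as an abstract algebra. -/
abbrev Alg : Type :=
  (∀ k : Fin η.r, lowerConst ℝ (η.nn k)) × (∀ l : Fin η.s, lowerConst ℂ (η.mm l))

/-- The algebra of possible diagonals of elements of `𝒦_{η,r,s}(ℝ)`. -/
abbrev Diag : Type := (Fin η.r → ℝ) × (Fin η.s → ℂ)

/-- The matrix of an element of the abstract algebra. -/
def toMat : η.Alg →ₐ[ℝ] Matrix (Fin n) (Fin n) ℝ where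
  toFun x := Matrix.reindex η.coord η.coord
    (Matrix.fromBlocks (Matrix.blockDiagonal' fun k => (x.1 k).1) 0 0
      (Matrix.blockDiagonal' fun l => realify _ (x.2 l).1))
  map_one' := by
    have h1 : (Matrix.blockDiagonal' fun k : Fin η.r =>
        (1 : Matrix (Fin (η.nn k)) (Fin (η.nn k)) ℝ)) = 1 := Matrix.blockDiagonal'_one
    have h2 : (Matrix.blockDiagonal' fun l : Fin η.s =>
      (1 : Matrix (Fin (η.mm l) × Fin 2) (Fin (η.mm l) × Fin 2) ℝ)) = 1 := Matrix.blockDiagonal'_one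
    simp [h1, h2]
  map_zero' := by
    have h1 : (Matrix.blockDiagonal' fun k : Fin η.r =>
        (0 : Matrix (Fin (η.nn k)) (Fin (η.nn k)) ℝ)) = 0 := Matrix.blockDiagonal'_zero
    have h2 : (Matrix.blockDiagonal' fun l : Fin η.s =>
      (0 : Matrix (Fin (η.mm l) × Fin 2) (Fin (η.mm l) × Fin 2) ℝ)) = 0 :=
      Matrix.blockDiagonal'_zero
    simp [h1, h2]
  map_add' x y := by
    have h1 := Matrix.blockDiagonal'_add (fun k => (x.1 k).1) (fun k => (y.1 k).1)
    have h2 := Matrix.blockDiagonal'_add (fun l => realify _ (x.2 l).1)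
      (fun l => realify _ (y.2 l).1)
    simp only [Prod.fst_add, Pi.add_apply, Subalgebra.coe_add, Prod.snd_add, map_add]
    have h3 : ∀ M N : Matrix η.Idx η.Idx ℝ, Matrix.reindex η.coord η.coord M +
      Matrix.reindex η.coord η.coord N = Matrix.reindex η.coord η.coord (M + N) := fun _ _ => rfl
    rw [h3, Matrix.fromBlocks_add, add_zero, add_zero, ← h1, ← h2]
    rfl
  map_mul' x y := by
    have h1 := Matrix.blockDiagonal'_mul (fun k => (x.1 k).1) (fun k => (y.1 k).1)
    have h2 := Matrix.blockDiagonal'_mul (fun l => realify _ (x.2 l).1)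
      (fun l => realify _ (y.2 l).1)
    simp only [Prod.fst_mul, Pi.mul_apply, Subalgebra.coe_mul, Prod.snd_mul, map_mul,
      Matrix.reindex_apply]
    rw [Matrix.submatrix_mul_equiv, Matrix.fromBlocks_multiply, h1, h2]
    simp
  commutes' c := by
    simp only [Algebra.algebraMap_eq_smul_one, Prod.smul_fst, Prod.smul_snd, Pi.smul_apply,
      Prod.fst_one, Prod.snd_one, Pi.one_apply]
    have h1 := Matrix.blockDiagonal'_smul c fun k : Fin η.r =>
        (1 : Matrix (Fin (η.nn k)) (Fin (η.nn k)) ℝ)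
    have h2 := Matrix.blockDiagonal'_smul c fun l : Fin η.s =>
      (1 : Matrix (Fin (η.mm l) × Fin 2) (Fin (η.mm l) × Fin 2) ℝ)
    have h3 : (Matrix.blockDiagonal' fun k : Fin η.r =>
        (1 : Matrix (Fin (η.nn k)) (Fin (η.nn k)) ℝ)) = 1 := Matrix.blockDiagonal'_one
    have h4 : (Matrix.blockDiagonal' fun l : Fin η.s =>
      (1 : Matrix (Fin (η.mm l) × Fin 2) (Fin (η.mm l) × Fin 2) ℝ)) = 1 := Matrix.blockDiagonal'_one
    have h5 : (Matrix.blockDiagonal' fun k : Fin η.r =>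
        (c • 1 : Matrix (Fin (η.nn k)) (Fin (η.nn k)) ℝ)) = c • 1 := by
      rw [← h3, ← h1]; rfl
    have h6 : (Matrix.blockDiagonal' fun l : Fin η.s =>
      (c • 1 : Matrix (Fin (η.mm l) × Fin 2) (Fin (η.mm l) × Fin 2) ℝ)) = c • 1 := by
      rw [← h4, ← h2]; rfl
    have h7 : ∀ l : Fin η.s, realify (η.mm l) ((c • (1 : lowerConst ℂ (η.mm l)) :
        lowerConst ℂ (η.mm l)) : Matrix _ _ ℂ) = c • 1 := fun l => by
      rw [← map_one (realify (η.mm l)), ← map_smul]; rfl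
    have h8 : Matrix.fromBlocks
        (c • 1 : Matrix (Σ k : Fin η.r, Fin (η.nn k)) (Σ k : Fin η.r, Fin (η.nn k)) ℝ) 0 0
        (c • 1 : Matrix (Σ l : Fin η.s, Fin (η.mm l) × Fin 2)
          (Σ l : Fin η.s, Fin (η.mm l) × Fin 2) ℝ) = c • 1 := by
      rw [← Matrix.fromBlocks_one, Matrix.fromBlocks_smul, smul_zero, smul_zero]
    simp only [h7]
    simp only [Subalgebra.coe_smul, Subalgebra.coe_one, h5, h6]
    rw [h8]
    simp [Matrix.submatrix_smul]

theorem toMat_apply (x : η.Alg) : η.toMat x = Matrix.reindex η.coord η.coord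
    (Matrix.fromBlocks (Matrix.blockDiagonal' fun k => (x.1 k).1) 0 0
      (Matrix.blockDiagonal' fun l => realify _ (x.2 l).1)) := rfl

theorem mem_K_iff {M : Matrix (Fin n) (Fin n) ℝ} : M ∈ η.K ↔ ∃ x : η.Alg, η.toMat x = M := by
  constructor
  · rintro ⟨A, B, hA, hB, rfl⟩
    choose Z hZ hZB using fun l => mem_BMat_iff.1 (hB l)
    refine ⟨⟨fun k => ⟨A k, hA k⟩, fun l => ⟨Z l, hZ l⟩⟩, ?_⟩
    simp only [toMat_apply, hZB]
  · rintro ⟨x, rfl⟩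
    exact ⟨_, _, fun k => (x.1 k).2, fun l => mem_BMat_iff.2 ⟨_, (x.2 l).2, rfl⟩, rfl⟩

theorem toMat_apply_inl (x : η.Alg) (k : Fin η.r) (i j : Fin (η.nn k)) :
    η.toMat x (η.coord (Sum.inl ⟨k, i⟩)) (η.coord (Sum.inl ⟨k, j⟩)) = (x.1 k).1 i j := by
  simp [toMat_apply, Matrix.blockDiagonal'_apply_eq]

theorem toMat_mulVec_inl (x : η.Alg) (v : Fin n → ℝ) (k : Fin η.r) (i : Fin (η.nn k)) :
    (η.toMat x *ᵥ v) (η.coord (Sum.inl ⟨k, i⟩)) =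
      ∑ j, (x.1 k).1 i j * v (η.coord (Sum.inl ⟨k, j⟩)) := by
  rw [Matrix.mulVec, dotProduct, ← Equiv.sum_comp η.coord, Fintype.sum_sum_type,
    Fintype.sum_sigma, Finset.sum_eq_single k]
  · simp [toMat_apply, Matrix.blockDiagonal'_apply_eq]
  · intro k' _ hk
    refine Finset.sum_eq_zero fun j _ => ?_
    simp [toMat_apply, Matrix.blockDiagonal'_apply_ne _ _ _ hk.symm]
  · simp

theorem toMat_mulVec_inr (x : η.Alg) (v : Fin n → ℝ) (l : Fin η.s) (i : Fin (η.mm l) × Fin 2) :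
    (η.toMat x *ᵥ v) (η.coord (Sum.inr ⟨l, i⟩)) =
      ∑ j, realify _ (x.2 l).1 i j * v (η.coord (Sum.inr ⟨l, j⟩)) := by
  rw [Matrix.mulVec, dotProduct, ← Equiv.sum_comp η.coord, Fintype.sum_sum_type,
    Fintype.sum_sigma, Fintype.sum_sigma, add_comm, Finset.sum_eq_single l]
  · simp [toMat_apply, Matrix.blockDiagonal'_apply_eq]
  · intro k' _ hk
    refine Finset.sum_eq_zero fun j _ => ?_
    simp [toMat_apply, Matrix.blockDiagonal'_apply_ne _ _ _ hk.symm]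
  · simp

theorem toMat_injective : Function.Injective η.toMat := by
  intro x y h
  rw [toMat_apply, toMat_apply, (Matrix.reindex η.coord η.coord).injective.eq_iff,
    Matrix.fromBlocks_inj] at h
  obtain ⟨h1, -, -, h2⟩ := h
  rw [Matrix.blockDiagonal'_inj] at h1 h2
  refine Prod.ext (funext fun k => Subtype.ext (congrFun h1 k)) (funext fun l => Subtype.ext ?_)
  ext i j
  have h3 : ∀ a b, realify _ (x.2 l).1 (i, a) (j, b) = realify _ (y.2 l).1 (i, a) (j, b) :=
    fun a b => congrFun (congrFun (congrFun h2 l) (i, a)) (j, b)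
  simp only [realify_apply] at h3
  exact Complex.ext (by simpa using h3 0 0) (by simpa using h3 1 0)

/-- The diagonal of an element. -/
def diag : η.Alg →ₐ[ℝ] η.Diag where
  toFun x := (fun k => lowerConst.diagVal ℝ (η.nn_pos k) (x.1 k),
    fun l => lowerConst.diagVal ℂ (η.mm_pos l) (x.2 l))
  map_one' := Prod.ext (funext fun _ => map_one _) (funext fun _ => map_one _)
  map_zero' := Prod.ext (funext fun _ => map_zero _) (funext fun _ => map_zero _)
  map_add' _ _ := Prod.ext (funext fun _ => map_add _ _ _) (funext fun _ => map_add _ _ _)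
  map_mul' _ _ := Prod.ext (funext fun _ => map_mul _ _ _) (funext fun _ => map_mul _ _ _)
  commutes' c := by
    ext l
    · simp
    · exact (lowerConst.diagVal ℂ (η.mm_pos l)).commutes (c : ℂ)

/-- The element with given scalar blocks. -/
def scalar : η.Diag →ₐ[ℝ] η.Alg where
  toFun x := (fun k => algebraMap _ _ (x.1 k), fun l => algebraMap _ _ (x.2 l))
  map_one' := Prod.ext (funext fun _ => map_one _) (funext fun _ => map_one _)
  map_zero' := Prod.ext (funext fun _ => map_zero _) (funext fun _ => map_zero _)
  map_add' _ _ := Prod.ext (funext fun _ => map_add _ _ _) (funext fun _ => map_add _ _ _)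
  map_mul' _ _ := Prod.ext (funext fun _ => map_mul _ _ _) (funext fun _ => map_mul _ _ _)
  commutes' _ := rfl

theorem scalar_fst_apply (d : η.Diag) (k : Fin η.r) (i j : Fin (η.nn k)) :
    ((η.scalar d).1 k).1 i j = if i = j then d.1 k else 0 :=
  Matrix.algebraMap_matrix_apply

theorem scalar_snd_apply (d : η.Diag) (l : Fin η.s) (i j : Fin (η.mm l)) :
    ((η.scalar d).2 l).1 i j = if i = j then d.2 l else 0 :=
  Matrix.algebraMap_matrix_apply

theorem diag_scalar (d : η.Diag) : η.diag (η.scalar d) = d :=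
  Prod.ext (funext fun k => (lowerConst.diagVal ℝ (η.nn_pos k)).commutes _)
    (funext fun l => (lowerConst.diagVal ℂ (η.mm_pos l)).commutes _)

/-- Block scalars come from the base field of each block, ℂ for the blocks of type 𝔹, so they are
central. -/
theorem commute_scalar (d : η.Diag) (x : η.Alg) : Commute (η.scalar d) x :=
  Prod.ext (funext fun _ => Algebra.commutes _ _) (funext fun _ => Algebra.commutes _ _)

theorem isNilpotent_of_diag_eq_zero {x : η.Alg} (hx : η.diag x = 0) : IsNilpotent x := by
  have h1 : ∀ k, lowerConst.diagVal ℝ (η.nn_pos k) (x.1 k) = 0 := fun k =>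
    congrFun (congrArg Prod.fst hx) k
  have h2 : ∀ l, lowerConst.diagVal ℂ (η.mm_pos l) (x.2 l) = 0 := fun l =>
    congrFun (congrArg Prod.snd hx) l
  -- A single exponent at least as large as every block size.
  refine ⟨(∑ k, η.nn k) + ∑ l, η.mm l, Prod.ext (funext fun k => ?_) (funext fun l => ?_)⟩
  · exact pow_eq_zero_of_le ((Finset.single_le_sum (fun _ _ => Nat.zero_le _)
      (Finset.mem_univ k)).trans (Nat.le_add_right _ _))
      (lowerConst.pow_eq_zero_of_diagVal_eq_zero (η.nn_pos k) _ (h1 k))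
  · exact pow_eq_zero_of_le ((Finset.single_le_sum (fun _ _ => Nat.zero_le _)
      (Finset.mem_univ l)).trans (Nat.le_add_left _ _))
      (lowerConst.pow_eq_zero_of_diagVal_eq_zero (η.mm_pos l) _ (h2 l))

/-- The first coordinates (real or complex) of a vector in each block. -/
def head : (Fin n → ℝ) →ₗ[ℝ] η.Diag where
  toFun v := (fun k => v (η.firstCoord k), fun l =>
    ⟨v (η.coord (Sum.inr ⟨l, (⟨0, η.mm_pos l⟩, 0)⟩)),
      v (η.coord (Sum.inr ⟨l, (⟨0, η.mm_pos l⟩, 1)⟩))⟩)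
  map_add' v w := rfl
  map_smul' c v := by
    ext l
    · simp
    · simp [Complex.ext_iff]

/-- By lower triangularity the first coordinate of each block sees only the diagonal. Thus
eigenvalues can be read from vectors. -/
theorem head_toMat_mulVec (x : η.Alg) (v : Fin n → ℝ) :
    η.head (η.toMat x *ᵥ v) = η.diag x * η.head v := by
  refine Prod.ext (funext fun k => ?_) (funext fun l => ?_)
  · change (η.toMat x *ᵥ v) (η.coord _) = (x.1 k).1 _ _ * v (η.coord _)
    rw [toMat_mulVec_inl, Finset.sum_eq_single ⟨0, η.nn_pos k⟩]
    · intro j _ hj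
      rw [(x.1 k).2.2 _ _ (Fin.lt_def.2 (Nat.pos_of_ne_zero fun h => hj (Fin.ext h))), zero_mul]
    · simp
  · have key : ∀ a, (η.toMat x *ᵥ v) (η.coord (Sum.inr ⟨l, (⟨0, η.mm_pos l⟩, a)⟩)) =
        ∑ b, realify _ (x.2 l).1 (⟨0, η.mm_pos l⟩, a) (⟨0, η.mm_pos l⟩, b) *
          v (η.coord (Sum.inr ⟨l, (⟨0, η.mm_pos l⟩, b)⟩)) := fun a => by
      rw [toMat_mulVec_inr, Fintype.sum_prod_type, Finset.sum_eq_single ⟨0, η.mm_pos l⟩]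
      · intro j _ hj
        refine Finset.sum_eq_zero fun b _ => ?_
        rw [realify_apply, (x.2 l).2.2 _ _ (Fin.lt_def.2 (Nat.pos_of_ne_zero fun h => hj (Fin.ext h)))]
        fin_cases a <;> fin_cases b <;> simp
      · simp
    change (⟨_, _⟩ : ℂ) = (x.2 l).1 _ _ * ⟨_, _⟩
    rw [key, key]
    simp [realify_apply, Fin.sum_univ_two, Complex.ext_iff]
    constructor <;> ring

theorem head_u₀ : η.head η.u₀ = 1 := by
  refine Prod.ext (funext fun k => ?_) (funext fun l => ?_)
  · change η.u₀ _ = 1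
    simp [u₀, firstCoord]
  · change (⟨η.u₀ _, η.u₀ _⟩ : ℂ) = 1
    simp [u₀, Complex.ext_iff]

theorem eigen_toMat (x : η.Alg) (k : Fin η.r) : η.eigen (η.toMat x) k = (η.diag x).1 k :=
  η.toMat_apply_inl x k _ _

/-- Multiplication by i sends (1, 0) to (0, 1), so the imaginary scalars produce the vectors `f`. -/
theorem toMat_scalar_mulVec_u₀ (t : Fin η.s → ℝ) :
    η.toMat (η.scalar (0, fun l => t l * Complex.I)) *ᵥ η.u₀ = ∑ l, t l • η.f l := by
  ext i
  obtain ⟨i, rfl⟩ := η.coord.surjective i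
  rcases i with ⟨k, i⟩ | ⟨l, i, a⟩
  · rw [toMat_mulVec_inl]
    simp [scalar_fst_apply, f]
  · rw [toMat_mulVec_inr, Fintype.sum_prod_type, Finset.sum_eq_single ⟨0, η.mm_pos l⟩,
      Finset.sum_apply, Finset.sum_eq_single l]
    · by_cases hi : i = ⟨0, η.mm_pos l⟩
      · subst hi
        fin_cases a <;> simp [scalar_snd_apply, f, u₀, realify_apply]
      · simp [scalar_snd_apply, f, u₀, realify_apply, hi]
        fin_cases a <;> simp
    · intro l' _ hl
      simp [f, hl.symm]
    · simp
    · intro j _ hj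
      have : (j : ℕ) ≠ 0 := fun h => hj (Fin.ext h)
      simp [u₀, this]
    · simp

end BlockType

end AbelianLinear
end

/-! ### The exponential on `K`: commutants, kernel and logarithms. -/

noncomputable section

theorem IsNilpotent.normedSpace_exp_eq {A : Type*} [Ring A] [Algebra ℚ A] [TopologicalSpace A]
    [IsTopologicalRing A] [T2Space A] {a : A} (ha : IsNilpotent a) :
    NormedSpace.exp a = IsNilpotent.exp a := by
  obtain ⟨k, hk⟩ := ha
  rw [NormedSpace.exp_eq_tsum_rat, IsNilpotent.exp_eq_sum hk]
  refine tsum_eq_sum fun i hi => ?_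
  rw [pow_eq_zero_of_le (by simpa using hi) hk, smul_zero]

theorem AlgHom.map_normedSpace_exp {A B : Type*} [NormedRing A] [NormedAlgebra ℝ A]
    [CompleteSpace A] [Ring B] [Algebra ℝ B] [TopologicalSpace B] [IsTopologicalRing B]
    [T2Space B] (φ : A →ₐ[ℝ] B) (hφ : Continuous φ) (a : A) :
    φ (NormedSpace.exp a) = NormedSpace.exp (φ a) := by
  have h := (NormedSpace.exp_series_hasSum_exp' (𝕂 := ℝ) a).map φ hφ
  rw [← h.tsum_eq, NormedSpace.exp_eq_tsum ℝ (𝔸 := B)]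
  exact tsum_congr fun i => by simp

namespace AbelianLinear

namespace BlockType

variable {n : ℕ} (η : BlockType n)

theorem isNilpotent_sub_scalar_diag (x : η.Alg) : IsNilpotent (x - η.scalar (η.diag x)) :=
  η.isNilpotent_of_diag_eq_zero (by rw [map_sub, diag_scalar, sub_self])

/-- The exponential on the abstract algebra, through the Jordan decomposition. -/
def expAlg (x : η.Alg) : η.Alg :=
  η.scalar (NormedSpace.exp (η.diag x)) * IsNilpotent.exp (x - η.scalar (η.diag x))

/-- The scalar and nilpotent parts commute, so the matrix exponential factors: the first factor is
computed in `Diag`, the second is a finite sum. -/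
theorem exp_toMat (x : η.Alg) : NormedSpace.exp (η.toMat x) = η.toMat (η.expAlg x) := by
  have hc : Continuous (η.toMat.comp η.scalar) :=
    (η.toMat.comp η.scalar).toLinearMap.continuous_of_finiteDimensional
  have h1 := (η.toMat.comp η.scalar).map_normedSpace_exp hc (η.diag x)
  have h2 : η.toMat x = η.toMat (η.scalar (η.diag x)) + η.toMat (x - η.scalar (η.diag x)) := by
    rw [← map_add, add_sub_cancel]
  have h3 := η.isNilpotent_sub_scalar_diag x
  rw [h2, Matrix.exp_add_of_commute _ _ ((η.commute_scalar _ _).map η.toMat),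
    (h3.map η.toMat).normedSpace_exp_eq, ← IsNilpotent.map_exp h3, expAlg, map_mul]
  exact congrArg (· * _) h1.symm

theorem diag_nilpotent_exp {x : η.Alg} (hx : η.diag x = 0) :
    η.diag (IsNilpotent.exp x) = 1 := by
  rw [IsNilpotent.map_exp (η.isNilpotent_of_diag_eq_zero hx), hx, IsNilpotent.exp_zero]

theorem diag_expAlg (x : η.Alg) : η.diag (η.expAlg x) = NormedSpace.exp (η.diag x) := by
  rw [expAlg, map_mul, diag_scalar, diag_nilpotent_exp, mul_one]
  rw [map_sub, diag_scalar, sub_self]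

theorem scalar_exp_neg_mul (d : η.Diag) :
    η.scalar (NormedSpace.exp (-d)) * η.scalar (NormedSpace.exp d) = 1 := by
  rw [← map_mul, ← NormedSpace.exp_add, neg_add_cancel, NormedSpace.exp_zero, map_one]

theorem nilpotent_exp_eq (x : η.Alg) : IsNilpotent.exp (x - η.scalar (η.diag x)) =
    η.scalar (NormedSpace.exp (-η.diag x)) * η.expAlg x := by
  rw [expAlg, ← mul_assoc, scalar_exp_neg_mul, one_mul]

/-- Up to a central unit, exp x is the exponential of the nilpotent part, which is a polynomial in
that exponential; the rest of x is central. -/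
theorem commute_of_commute_expAlg {x z : η.Alg} (h : Commute z (η.expAlg x)) : Commute z x := by
  have h1 : Commute z (x - η.scalar (η.diag x)) := by
    refine (η.isNilpotent_sub_scalar_diag x).commute_of_commute_exp ?_
    rw [nilpotent_exp_eq]
    exact (η.commute_scalar _ _).symm.mul_right h
  simpa using h1.add_right (η.commute_scalar (η.diag x) z).symm

theorem exp_diag_fst (d : η.Diag) (k : Fin η.r) :
    (NormedSpace.exp d).1 k = Real.exp (d.1 k) := by
  rw [Prod.fst_exp, Pi.coe_exp, Real.exp_eq_exp_ℝ]

theorem exp_diag_snd (d : η.Diag) (l : Fin η.s) :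
    (NormedSpace.exp d).2 l = Complex.exp (d.2 l) := by
  rw [Prod.snd_exp, Pi.coe_exp, Complex.exp_eq_exp_ℂ]

theorem exp_diag_eq_iff {d e : η.Diag} : NormedSpace.exp d = NormedSpace.exp e ↔
    ∃ t : Fin η.s → ℤ, d = e + (0, fun l => ((2 * Real.pi * (t l : ℝ) : ℝ) : ℂ) * Complex.I) := by
  constructor
  · intro h
    have h1 : ∀ k, d.1 k = e.1 k := fun k => by
      have := congrFun (congrArg Prod.fst h) k
      rw [exp_diag_fst, exp_diag_fst] at this
      exact Real.exp_injective this
    have h2 : ∀ l, ∃ t : ℤ, d.2 l = e.2 l + t * (2 * Real.pi * Complex.I) := fun l => by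
      have := congrFun (congrArg Prod.snd h) l
      rw [exp_diag_snd, exp_diag_snd] at this
      exact Complex.exp_eq_exp_iff_exists_int.1 this
    choose t ht using h2
    refine ⟨t, Prod.ext (funext fun k => by simp [h1]) (funext fun l => ?_)⟩
    simp only [ht, Prod.snd_add, Pi.add_apply]
    push_cast
    ring
  · rintro ⟨t, rfl⟩
    refine Prod.ext (funext fun k => ?_) (funext fun l => ?_)
    · simp [exp_diag_fst]
    · rw [exp_diag_snd, exp_diag_snd, Complex.exp_eq_exp_iff_exists_int]
      refine ⟨t l, ?_⟩
      simp only [Prod.snd_add, Pi.add_apply]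
      push_cast
      ring

/-- The elements of the kernel of the exponential. -/
def period (t : Fin η.s → ℤ) : η.Alg :=
  η.scalar (0, fun l => ((2 * Real.pi * (t l : ℝ) : ℝ) : ℂ) * Complex.I)

/-- The diagonals differ by a period, whose exponential is 1, so the unipotent factors agree; the
nilpotent exponential is injective. -/
theorem expAlg_eq_iff {x y : η.Alg} : η.expAlg x = η.expAlg y ↔ ∃ t, x = y + η.period t := by
  constructor
  · intro h
    have h1 : NormedSpace.exp (η.diag x) = NormedSpace.exp (η.diag y) := by
      rw [← diag_expAlg, ← diag_expAlg, h]
    obtain ⟨t, ht⟩ := η.exp_diag_eq_iff.1 h1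
    have hneg : NormedSpace.exp (-η.diag x) = NormedSpace.exp (-η.diag y) := by
      obtain ⟨t, ht⟩ := η.exp_diag_eq_iff.1 h1.symm
      exact η.exp_diag_eq_iff.2 ⟨t, by rw [ht]; abel⟩
    have h2 : x - η.scalar (η.diag x) = y - η.scalar (η.diag y) := by
      refine (η.isNilpotent_sub_scalar_diag x).eq_of_exp_eq (η.isNilpotent_sub_scalar_diag y) ?_
      rw [nilpotent_exp_eq, nilpotent_exp_eq, hneg, h]
    refine ⟨t, ?_⟩
    rw [ht, map_add, sub_eq_iff_eq_add] at h2
    rw [h2, period]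
    abel
  · rintro ⟨t, rfl⟩
    have h1 : NormedSpace.exp (η.diag (y + η.period t)) = NormedSpace.exp (η.diag y) := by
      rw [exp_diag_eq_iff]
      exact ⟨t, by rw [map_add, period, diag_scalar]⟩
    rw [expAlg, h1, expAlg, map_add, period, diag_scalar, map_add, add_sub_add_right_eq_sub]

theorem exists_expAlg_eq {y : η.Alg} {d : η.Diag} (h : η.diag y = NormedSpace.exp d) :
    ∃ x, η.expAlg x = y ∧ ∀ z, Commute z y → Commute z x := by
  set m := η.scalar (NormedSpace.exp (-d)) * y - 1 with hm
  have hd : NormedSpace.exp (-d) * NormedSpace.exp d = 1 := by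
    rw [← NormedSpace.exp_add, neg_add_cancel, NormedSpace.exp_zero]
  have hm0 : η.diag m = 0 := by
    rw [hm, map_sub, map_mul, diag_scalar, h, hd, map_one, sub_self]
  obtain ⟨L, hL, hLn, hLe⟩ := (η.isNilpotent_of_diag_eq_zero hm0).exists_exp_eq_one_add
  -- The diagonal of L is nilpotent with exponential 1.
  have hL0 : η.diag L = 0 := by
    have := hLn.map η.diag
    exact this.eq_zero_of_exp_eq_one (by
      rw [← IsNilpotent.map_exp hLn, hLe, map_add, map_one, hm0, add_zero])
  have hx : η.expAlg (η.scalar d + L) = y := by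
    rw [expAlg, map_add, diag_scalar, hL0, add_zero, add_sub_cancel_left, hLe, hm,
      add_sub_cancel, ← mul_assoc, ← map_mul, mul_comm, hd, map_one, one_mul]
  exact ⟨_, hx, fun z hz => η.commute_of_commute_expAlg (hx ▸ hz)⟩

theorem exists_exp_diag_eq {d : η.Diag} (h1 : ∀ k, 0 < d.1 k) (h2 : ∀ l, d.2 l ≠ 0) :
    ∃ e : η.Diag, NormedSpace.exp e = d := by
  refine ⟨(fun k => Real.log (d.1 k), fun l => Complex.log (d.2 l)),
    Prod.ext (funext fun k => ?_) (funext fun l => ?_)⟩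
  · rw [exp_diag_fst, Real.exp_log (h1 k)]
  · rw [exp_diag_snd, Complex.exp_log (h2 l)]

theorem toMat_period_mulVec_u₀ (t : Fin η.s → ℤ) :
    η.toMat (η.period t) *ᵥ η.u₀ = ∑ l, (2 * Real.pi * (t l : ℝ)) • η.f l :=
  η.toMat_scalar_mulVec_u₀ _

end BlockType

end AbelianLinear
end

/-! ### Differentiability and continuity of the matrix exponential. -/

noncomputable section
section
attribute [local instance] Matrix.linftyOpNormedRing Matrix.linftyOpNormedAlgebra

theorem Matrix.hasStrictFDerivAt_exp_comp {m : Type*} [Fintype m] [DecidableEq m]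
    {E F : Type*} [NormedAddCommGroup E] [NormedSpace ℝ E] [FiniteDimensional ℝ E]
    [NormedAddCommGroup F] [NormedSpace ℝ F] [FiniteDimensional ℝ F]
    (ψ : E →ₗ[ℝ] Matrix m m ℝ) (ε : Matrix m m ℝ →ₗ[ℝ] F) :
    HasStrictFDerivAt (fun v => ε (NormedSpace.exp (ψ v)))
      (LinearMap.toContinuousLinearMap (ε ∘ₗ ψ)) 0 := by
  have h1 : HasStrictFDerivAt (NormedSpace.exp : Matrix m m ℝ → Matrix m m ℝ)
      (1 : Matrix m m ℝ →L[ℝ] Matrix m m ℝ) (LinearMap.toContinuousLinearMap ψ 0) := by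
    rw [map_zero]
    exact hasStrictFDerivAt_exp_zero
  exact (LinearMap.toContinuousLinearMap ε).hasStrictFDerivAt.comp 0
    (h1.comp 0 (LinearMap.toContinuousLinearMap ψ).hasStrictFDerivAt)

theorem Matrix.continuous_exp {m : Type*} [Fintype m] [DecidableEq m] :
    Continuous (NormedSpace.exp : Matrix m m ℝ → Matrix m m ℝ) := by
  let _ : NormedAlgebra ℚ (Matrix m m ℝ) := NormedAlgebra.restrictScalars ℚ ℝ _
  exact NormedSpace.exp_continuous
end
end

/-! ### Kronecker's theorem and its rank form. -/

noncomputable section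

section DenseSubgroup

open Filter Topology

variable {E : Type*} [NormedAddCommGroup E] [NormedSpace ℝ E] [FiniteDimensional ℝ E]

/-- Otherwise nonzero elements tend to 0; a limit u of their directions spans a line in H, since
integer multiples of ever shorter vectors approximate every t u. -/
theorem AddSubgroup.discreteTopology_of_isClosed_of_no_line (H : AddSubgroup E)
    (hH : IsClosed (H : Set E)) (hline : ∀ x : E, (∀ t : ℝ, t • x ∈ H) → x = 0) :
    DiscreteTopology H := by
  rw [discreteTopology_iff_isOpen_singleton_zero, Metric.isOpen_singleton_iff]
  by_contra! hcon
  have h1 : ∀ k : ℕ, ∃ h ∈ H, h ≠ 0 ∧ ‖h‖ < 1 / ((k : ℝ) + 1) := fun k => by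
    obtain ⟨⟨y, hy⟩, hd, hne⟩ := hcon (1 / ((k : ℝ) + 1)) Nat.one_div_pos_of_nat
    refine ⟨y, hy, fun h => hne (Subtype.ext h), ?_⟩
    rw [dist_zero_right] at hd
    exact hd
  choose h hhH hh0 hhn using h1
  have hpos : ∀ k, 0 < ‖h k‖ := fun k => norm_pos_iff.2 (hh0 k)
  have hlim : Tendsto (fun k => ‖h k‖) atTop (𝓝 0) :=
    squeeze_zero (fun k => norm_nonneg _) (fun k => (hhn k).le)
      tendsto_one_div_add_atTop_nhds_zero_nat
  have hs : ∀ k, ‖h k‖⁻¹ • h k ∈ Metric.sphere (0 : E) 1 := fun k => by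
    rw [mem_sphere_zero_iff_norm, norm_smul, norm_inv, norm_norm, inv_mul_cancel₀ (hpos k).ne']
  have : ProperSpace E := FiniteDimensional.proper ℝ E
  obtain ⟨u, hu, φ, hφ, hlimu⟩ := (isCompact_sphere (0 : E) 1).tendsto_subseq hs
  have hu0 : u = 0 := by
    refine hline u fun t => ?_
    have hlim2 : Tendsto (fun k => ⌊t / ‖h (φ k)‖⌋ • h (φ k)) atTop (𝓝 (t • u)) := by
      have e : ∀ k, ⌊t / ‖h (φ k)‖⌋ • h (φ k) = t • (‖h (φ k)‖⁻¹ • h (φ k)) -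
          Int.fract (t / ‖h (φ k)‖) • h (φ k) := fun k => by
        rw [← Int.cast_smul_eq_zsmul ℝ, smul_smul, ← sub_smul, ← div_eq_mul_inv, Int.self_sub_fract]
      have e2 : Tendsto (fun k => Int.fract (t / ‖h (φ k)‖) • h (φ k)) atTop (𝓝 0) := by
        refine squeeze_zero_norm (fun k => ?_) (hlim.comp hφ.tendsto_atTop)
        rw [norm_smul, Real.norm_eq_abs, Int.abs_fract]
        exact mul_le_of_le_one_left (norm_nonneg _) (Int.fract_lt_one _).le
      simp only [e]
      simpa using (hlimu.const_smul t).sub e2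
    exact hH.mem_of_tendsto hlim2 (Eventually.of_forall fun k => H.zsmul_mem (hhH _) _)
  rw [hu0] at hu
  simp at hu

theorem AddSubgroup.exists_integral_dual_of_discrete [Nontrivial E] (H : AddSubgroup E)
    [DiscreteTopology H] : ∃ w : E →ₗ[ℝ] ℝ, w ≠ 0 ∧ ∀ h ∈ H, ∃ m : ℤ, w h = m := by
  by_cases hV : Submodule.span ℝ (H : Set E) = ⊤
  · let L : Submodule ℤ E := AddSubgroup.toIntSubmodule H
    have : DiscreteTopology L := ‹DiscreteTopology H›
    have : IsZLattice ℝ L := ⟨hV⟩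
    let b := Module.Free.chooseBasis ℤ L
    let B := b.ofZLatticeBasis ℝ L
    obtain ⟨i⟩ := B.index_nonempty
    refine ⟨B.coord i, fun h => ?_, fun h hh => ⟨b.repr ⟨h, hh⟩ i, ?_⟩⟩
    · have := LinearMap.congr_fun h (B i)
      simp at this
    · exact b.ofZLatticeBasis_repr_apply ℝ L ⟨h, hh⟩ i
  · obtain ⟨w, hw, hle⟩ := Submodule.exists_le_ker_of_lt_top _ (lt_top_iff_ne_top.2 hV)
    exact ⟨w, hw, fun h hh => ⟨0, by simpa using hle (Submodule.subset_span hh)⟩⟩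

/-- Split off the largest linear subspace V contained in H. On a complement W the trace of H
contains no line, hence is discrete, and a form found there is extended by 0 on V. Projecting along
V keeps elements of H in H. -/
theorem AddSubgroup.exists_integral_dual_of_isClosed (H : AddSubgroup E)
    (hH : IsClosed (H : Set E)) (hne : H ≠ ⊤) :
    ∃ w : E →ₗ[ℝ] ℝ, w ≠ 0 ∧ ∀ h ∈ H, ∃ m : ℤ, w h = m := by
  let V : Submodule ℝ E :=
    { carrier := {x | ∀ t : ℝ, t • x ∈ H}
      add_mem' := fun {x y} hx hy t => by
        rw [smul_add]
        exact H.add_mem (hx t) (hy t)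
      zero_mem' := fun t => by
        rw [smul_zero]
        exact H.zero_mem
      smul_mem' := fun c x hx t => by
        rw [smul_smul]
        exact hx _ }
  have hVH : ∀ x ∈ V, x ∈ H := fun x hx => by simpa using hx 1
  obtain ⟨W, hVW⟩ := V.exists_isCompl
  let H' : AddSubgroup W := H.comap W.subtype.toAddMonoidHom
  have hd : DiscreteTopology H' := by
    refine H'.discreteTopology_of_isClosed_of_no_line (hH.preimage continuous_subtype_val)
      fun x hx => ?_
    have h1 : (x : E) ∈ V := fun t => hx t
    exact Subtype.ext (Submodule.disjoint_def.1 hVW.disjoint x h1 x.2)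
  have hW : Nontrivial W := by
    rw [Submodule.nontrivial_iff_ne_bot]
    rintro rfl
    refine hne (eq_top_iff.2 fun x _ => hVH x ?_)
    rw [eq_top_of_isCompl_bot hVW]
    trivial
  obtain ⟨w, hw0, hw⟩ := H'.exists_integral_dual_of_discrete
  refine ⟨w ∘ₗ W.projectionOnto V hVW.symm, fun h => hw0 ?_, fun h hh => ?_⟩
  · ext x
    have := LinearMap.congr_fun h x
    rwa [LinearMap.comp_apply, Submodule.projectionOnto_apply_left] at this
  · refine hw _ ?_
    have h1 : h - (W.projectionOnto V hVW.symm h : E) ∈ V := by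
      rw [← Submodule.projectionOnto_apply_eq_zero_iff hVW.symm, map_sub,
        Submodule.projectionOnto_apply_left, sub_self]
    have h2 := H.sub_mem hh (hVH _ h1)
    rwa [sub_sub_cancel] at h2

theorem AddSubgroup.dense_iff_forall_integral_dual (H : AddSubgroup E) :
    Dense (H : Set E) ↔ ∀ w : E →ₗ[ℝ] ℝ, (∀ h ∈ H, ∃ m : ℤ, w h = m) → w = 0 := by
  constructor
  · intro hd w hw
    by_contra hw0
    obtain ⟨x, hx⟩ : ∃ x, w x ≠ 0 := by
      by_contra! h
      exact hw0 (LinearMap.ext h)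
    -- A strip containing no integer value of w; it is nonempty, as w takes the value 1/2.
    have hopen : IsOpen (w ⁻¹' Set.Ioo (1 / 4) (3 / 4)) :=
      isOpen_Ioo.preimage w.continuous_of_finiteDimensional
    obtain ⟨h, hmem, hh⟩ := hd.exists_mem_open hopen ⟨(1 / 2 / w x) • x, by
      rw [Set.mem_preimage, map_smul, smul_eq_mul, div_mul_cancel₀ _ hx]
      norm_num⟩
    obtain ⟨m, hm⟩ := hw h hmem
    rw [Set.mem_preimage, hm] at hh
    have h1 : (0 : ℝ) < m := by linarith [hh.1]
    have h2 : (m : ℝ) < 1 := by linarith [hh.2]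
    norm_cast at h1 h2
    omega
  · intro hw
    by_contra hd
    have hne : H.topologicalClosure ≠ ⊤ := fun h => hd (by
      rw [dense_iff_closure_eq, ← AddSubgroup.topologicalClosure_coe, h, AddSubgroup.coe_top])
    obtain ⟨w, hw0, hwi⟩ := H.topologicalClosure.exists_integral_dual_of_isClosed
      H.isClosed_topologicalClosure hne
    exact hw0 (hw w fun h hh => hwi h (H.le_topologicalClosure hh))

end DenseSubgroup

theorem Matrix.rank_eq_card_iff {m n K : Type*} [Fintype m] [Fintype n] [Field K]
    (M : Matrix m n K) : M.rank = Fintype.card m ↔ ∀ v, v ᵥ* M = 0 → v = 0 := by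
  have h1 : M.rank = Fintype.card m ↔ LinearIndependent K M.row := by
    rw [linearIndependent_iff_card_eq_finrank_span, Matrix.rank_eq_finrank_span_row, eq_comm]
    rfl
  rw [h1, ← Matrix.vecMul_injective_iff, ← Matrix.coe_vecMulLinear, ← LinearMap.ker_eq_bot,
    LinearMap.ker_eq_bot']
  rfl

/-- Kronecker's theorem: density of a finitely generated subgroup as a rank condition. -/
theorem dense_int_span_iff_rank {n : ℕ} {J₁ J₂ : Type*} [Fintype J₁] [Fintype J₂]
    [Nonempty (J₁ ⊕ J₂)] (x : J₁ → Fin n → ℝ) (y : J₂ → Fin n → ℝ) :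
    Dense {z | ∃ (a : J₁ → ℤ) (b : J₂ → ℤ),
        z = ∑ k, (a k : ℝ) • x k + ∑ l, (b l : ℝ) • y l} ↔
      ∀ (σ : J₁ → ℤ) (t : J₂ → ℤ), (σ, t) ≠ 0 →
        (Matrix.fromBlocks (Matrix.of fun i k => x k i) (Matrix.of fun i l => y l i)
          (Matrix.of fun (_ : Unit) k => (σ k : ℝ))
          (Matrix.of fun (_ : Unit) l => (t l : ℝ))).rank = n + 1 := by
  classical
  let H : AddSubgroup (Fin n → ℝ) := AddSubgroup.closure (Set.range (Sum.elim x y))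
  have hHmem : ∀ z, z ∈ H ↔ ∃ (a : J₁ → ℤ) (b : J₂ → ℤ),
        z = ∑ k, (a k : ℝ) • x k + ∑ l, (b l : ℝ) • y l := fun z => by
    constructor
    · intro hz
      induction hz using AddSubgroup.closure_induction with
      | mem z hz =>
        obtain ⟨k | l, rfl⟩ := hz
        · refine ⟨Pi.single k 1, 0, ?_⟩
          rw [Finset.sum_eq_single k] <;> simp +contextual
        · refine ⟨0, Pi.single l 1, ?_⟩
          rw [Finset.sum_eq_single (s := Finset.univ (α := J₂)) l] <;> simp +contextual
      | zero => exact ⟨0, 0, by simp⟩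
      | add z z' _ _ h h' =>
        obtain ⟨a, b, rfl⟩ := h
        obtain ⟨a', b', rfl⟩ := h'
        refine ⟨a + a', b + b', ?_⟩
        simp only [Pi.add_apply, Int.cast_add, add_smul, Finset.sum_add_distrib]
        abel
      | neg z _ h =>
        obtain ⟨a, b, rfl⟩ := h
        refine ⟨-a, -b, ?_⟩
        simp only [Pi.neg_apply, Int.cast_neg, neg_smul, Finset.sum_neg_distrib]
        abel
    · rintro ⟨a, b, rfl⟩
      refine H.add_mem (H.sum_mem fun k _ => ?_) (H.sum_mem fun l _ => ?_)
      · rw [Int.cast_smul_eq_zsmul]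
        exact H.zsmul_mem (AddSubgroup.subset_closure ⟨Sum.inl k, rfl⟩) _
      · rw [Int.cast_smul_eq_zsmul]
        exact H.zsmul_mem (AddSubgroup.subset_closure ⟨Sum.inr l, rfl⟩) _
  have hset : {z | ∃ (a : J₁ → ℤ) (b : J₂ → ℤ),
        z = ∑ k, (a k : ℝ) • x k + ∑ l, (b l : ℝ) • y l} = (H : Set (Fin n → ℝ)) :=
    Set.ext fun z => (hHmem z).symm
  have hint : ∀ w : (Fin n → ℝ) →ₗ[ℝ] ℝ, (∀ h ∈ H, ∃ m : ℤ, w h = m) ↔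
      (∀ k, ∃ m : ℤ, w (x k) = m) ∧ ∀ l, ∃ m : ℤ, w (y l) = m := fun w => by
    constructor
    · exact fun h => ⟨fun k => h _ (AddSubgroup.subset_closure ⟨Sum.inl k, rfl⟩),
        fun l => h _ (AddSubgroup.subset_closure ⟨Sum.inr l, rfl⟩)⟩
    · rintro ⟨h1, h2⟩ h hh
      choose m hm using h1
      choose m' hm' using h2
      obtain ⟨a, b, rfl⟩ := (hHmem h).1 hh
      refine ⟨∑ k, a k * m k + ∑ l, b l * m' l, ?_⟩
      simp [hm, hm']
  rw [hset, AddSubgroup.dense_iff_forall_integral_dual]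
  have hrank : ∀ (σ : J₁ → ℤ) (t : J₂ → ℤ),
      (Matrix.fromBlocks (Matrix.of fun i k => x k i) (Matrix.of fun i l => y l i)
          (Matrix.of fun (_ : Unit) k => (σ k : ℝ))
          (Matrix.of fun (_ : Unit) l => (t l : ℝ))).rank = n + 1 ↔
      ∀ (v : Fin n → ℝ) (c : ℝ), (∀ k, v ⬝ᵥ x k + c * σ k = 0) → (∀ l, v ⬝ᵥ y l + c * t l = 0) →
        v = 0 ∧ c = 0 := fun σ t => by
    have hc : n + 1 = Fintype.card (Fin n ⊕ Unit) := by simp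
    rw [hc, Matrix.rank_eq_card_iff]
    constructor
    · intro h v c h1 h2
      have := h (Sum.elim v fun _ => c) (by
        rw [Matrix.vecMul_fromBlocks]
        ext (k | l)
        · simpa [Matrix.vecMul, dotProduct] using h1 k
        · simpa [Matrix.vecMul, dotProduct] using h2 l)
      exact ⟨funext fun i => congrFun this (Sum.inl i), congrFun this (Sum.inr ())⟩
    · intro h v hv
      rw [Matrix.vecMul_fromBlocks] at hv
      obtain ⟨h1, h2⟩ := h (v ∘ Sum.inl) (v (Sum.inr ()))
        (fun k => by simpa [Matrix.vecMul, dotProduct] using congrFun hv (Sum.inl k))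
        (fun l => by simpa [Matrix.vecMul, dotProduct] using congrFun hv (Sum.inr l))
      ext (i | i)
      · exact congrFun h1 i
      · exact h2
  simp only [hint, hrank]
  constructor
  · intro h σ t hst v c h1 h2
    -- For a left null vector (v, c), the form v vanishes on the generators if c = 0, and otherwise
    -- -v/c takes the integer values σ, t on them.
    by_cases hc : c = 0
    · subst hc
      refine ⟨?_, rfl⟩
      have := h (dotProductEquiv ℝ (Fin n) v)
        ⟨fun k => ⟨0, by simpa using h1 k⟩, fun l => ⟨0, by simpa using h2 l⟩⟩
      simpa using this
    · exfalso
      have := h (dotProductEquiv ℝ (Fin n) (-c⁻¹ • v))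
        ⟨fun k => ⟨σ k, by
          have := h1 k
          simp only [dotProductEquiv_apply_apply, smul_dotProduct, smul_eq_mul]
          field_simp
          linarith⟩, fun l => ⟨t l, by
          have := h2 l
          simp only [dotProductEquiv_apply_apply, smul_dotProduct, smul_eq_mul]
          field_simp
          linarith⟩⟩
      have hv : v = 0 := by simpa [hc] using this
      subst hv
      refine hst (Prod.ext (funext fun k => ?_) (funext fun l => ?_))
      · simpa [hc] using h1 k
      · simpa [hc] using h2 l
  · rintro h w ⟨h1, h2⟩
    obtain ⟨v, rfl⟩ := (dotProductEquiv ℝ (Fin n)).surjective w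
    choose m hm using h1
    choose m' hm' using h2
    simp only [dotProductEquiv_apply_apply] at hm hm'
    -- An integral form v with values m, m' gives the left null vector (v, -1). If all values
    -- vanish, (v, 0) works for any nonzero integer row; such a row exists because there is at least
    -- one generator.
    by_cases h0 : (m, m') = 0
    · obtain ⟨hm0, hm0'⟩ := Prod.ext_iff.1 h0
      simp only [Prod.fst_zero, Prod.snd_zero] at hm0 hm0'
      have := h (fun _ => 1) (fun _ => 1) (fun h => by
        obtain ⟨j | j⟩ := ‹Nonempty (J₁ ⊕ J₂)›
        · simpa using congrFun (congrArg Prod.fst h) j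
        · simpa using congrFun (congrArg Prod.snd h) j) v 0 (by simp [hm, hm0])
        (by simp [hm', hm0'])
      simp [this.1]
    · have := h m m' h0 v (-1) (by simp [hm]) (by simp [hm'])
      simp [this.1]
end

/-! ### Commutative spaces of matrices with a cyclic vector. -/

noncomputable section

namespace Matrix

theorem commute_of_mem_span {m : Type*} [Fintype m] [DecidableEq m] {T : Set (Matrix m m ℝ)}
    {Z Y : Matrix m m ℝ} (h : ∀ Y ∈ T, Commute Z Y) (hY : Y ∈ Submodule.span ℝ T) :
    Commute Z Y := by
  induction hY using Submodule.span_induction with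
  | mem Y hY => exact h Y hY
  | zero => exact Commute.zero_right Z
  | add X Y _ _ hX hY => exact hX.add_right hY
  | smul c X _ hX => exact hX.smul_right c

theorem commute_of_mem_span_of_mem_span {m : Type*} [Fintype m] [DecidableEq m]
    {T : Set (Matrix m m ℝ)} (h : ∀ X ∈ T, ∀ Y ∈ T, Commute X Y) {X Y : Matrix m m ℝ}
    (hX : X ∈ Submodule.span ℝ T) (hY : Y ∈ Submodule.span ℝ T) : Commute X Y :=
  commute_of_mem_span (fun _ hZ => (commute_of_mem_span (fun _ hW => h _ hZ _ hW) hX).symm) hY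

/-- Evaluation of matrices at a vector. -/
def evalAt {m : Type*} [Fintype m] (u : m → ℝ) : Matrix m m ℝ →ₗ[ℝ] (m → ℝ) where
  toFun X := X *ᵥ u
  map_add' X Y := Matrix.add_mulVec X Y u
  map_smul' c X := Matrix.smul_mulVec c X u

@[simp]
theorem evalAt_apply {m : Type*} [Fintype m] (u : m → ℝ) (X : Matrix m m ℝ) :
    evalAt u X = X *ᵥ u := rfl

/-- A commutative space of matrices with a cyclic vector is parametrized linearly by its values
at this vector, and it is its own commutant. -/
theorem exists_evalAt_inverse {m : Type*} [Fintype m] [DecidableEq m]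
    (S : Submodule ℝ (Matrix m m ℝ)) (hcomm : ∀ X ∈ S, ∀ Y ∈ S, Commute X Y) (u : m → ℝ)
    (hS : S.map (evalAt u) = ⊤) :
    ∃ ψ : (m → ℝ) →ₗ[ℝ] Matrix m m ℝ, (∀ v, ψ v ∈ S) ∧ (∀ v, ψ v *ᵥ u = v) ∧
      ∀ X, (∀ Y ∈ S, Commute X Y) → ψ (X *ᵥ u) = X := by
  have hsurj : ∀ v, ∃ X ∈ S, X *ᵥ u = v := fun v => by
    have : v ∈ S.map (evalAt u) := hS ▸ trivial
    exact this
  -- A matrix commuting with S and killing u kills S u, which is everything.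
  have huniq : ∀ X, (∀ Y ∈ S, Commute X Y) → X *ᵥ u = 0 → X = 0 := fun X hX h0 => by
    refine Matrix.ext_of_mulVec_single fun i => ?_
    obtain ⟨Y, hY, hYv⟩ := hsurj (Pi.single i 1)
    rw [← hYv, Matrix.mulVec_mulVec, (hX Y hY).eq, ← Matrix.mulVec_mulVec, h0, Matrix.mulVec_zero,
      Matrix.zero_mulVec]
  let e : S →ₗ[ℝ] (m → ℝ) := evalAt u ∘ₗ S.subtype
  have he : Function.Bijective e := by
    constructor
    · rw [← LinearMap.ker_eq_bot, LinearMap.ker_eq_bot']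
      exact fun X hX => Subtype.ext (huniq X (fun Y hY => hcomm X X.2 Y hY) hX)
    · intro v
      obtain ⟨X, hX, hXv⟩ := hsurj v
      exact ⟨⟨X, hX⟩, hXv⟩
  let E := LinearEquiv.ofBijective e he
  have hE : ∀ v, (E.symm v : Matrix m m ℝ) *ᵥ u = v := fun v => E.apply_symm_apply v
  refine ⟨S.subtype ∘ₗ E.symm.toLinearMap, fun v => (E.symm v).2, hE, fun X hX => ?_⟩
  have := huniq ((E.symm (X *ᵥ u) : Matrix m m ℝ) - X)
    (fun Y hY => (hcomm _ (E.symm _).2 Y hY).sub_left (hX Y hY)) (by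
      rw [Matrix.sub_mulVec, hE, sub_self])
  exact sub_eq_zero.1 this

theorem map_evalAt_eq_top {m : Type*} [Fintype m] {S : Submodule ℝ (Matrix m m ℝ)}
    {u : m → ℝ} {D : Set (m → ℝ)} (hD : Dense D) (h : ∀ v ∈ D, ∃ X ∈ S, v = X *ᵥ u) :
    S.map (evalAt u) = ⊤ := by
  have h1 : D ⊆ (S.map (evalAt u) : Set (m → ℝ)) := fun v hv => by
    obtain ⟨X, hX, rfl⟩ := h v hv
    exact ⟨X, hX, rfl⟩
  have h2 := (hD.mono h1).closure_eq
  rw [(Submodule.closed_of_finiteDimensional _).closure_eq] at h2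
  exact SetLike.coe_injective h2

end Matrix

/-! ### The group of logarithms of squares, and density of the orbit near `u₀`. -/

namespace AbelianLinear

namespace BlockType

variable {n : ℕ} (η : BlockType n) {G : Subgroup (GL (Fin n) ℝ)}

theorem commute_coe (hG : ∀ X ∈ G, ∀ Y ∈ G, X * Y = Y * X) {M N : GL (Fin n) ℝ} (hM : M ∈ G)
    (hN : N ∈ G) : Commute (M : Matrix (Fin n) (Fin n) ℝ) (N : Matrix (Fin n) (Fin n) ℝ) := by
  have := congrArg (fun X : GL (Fin n) ℝ => (X : Matrix (Fin n) (Fin n) ℝ)) (hG M hM N hN)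
  rwa [Units.val_mul, Units.val_mul] at this

theorem commute_of_toMat {x y : η.Alg} (h : Commute (η.toMat x) (η.toMat y)) : Commute x y :=
  η.toMat_injective (by rw [map_mul, map_mul, h.eq])

/-- N commutes with M² = exp x, hence with x; this makes all logarithms of squares commute. -/
theorem commute_toMat_of_sq_eq_exp (hG : ∀ X ∈ G, ∀ Y ∈ G, X * Y = Y * X)
    (hK : ∀ M ∈ G, (M : Matrix (Fin n) (Fin n) ℝ) ∈ η.K) {x : η.Alg} {M N : GL (Fin n) ℝ}
    (hM : M ∈ G) (hN : N ∈ G)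
    (hx : ((M ^ 2 : GL (Fin n) ℝ) : Matrix (Fin n) (Fin n) ℝ) = NormedSpace.exp (η.toMat x)) :
    Commute (N : Matrix (Fin n) (Fin n) ℝ) (η.toMat x) := by
  obtain ⟨z, hz⟩ := η.mem_K_iff.1 (hK N hN)
  rw [← hz]
  refine Commute.map (η.commute_of_commute_expAlg (η.commute_of_toMat ?_)) η.toMat
  rw [← exp_toMat, ← hx, hz]
  exact commute_coe hG hN (G.pow_mem hM 2)

/-- The elements whose exponential is the square of an element of `G`. -/
def sqLog (hG : ∀ X ∈ G, ∀ Y ∈ G, X * Y = Y * X)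
    (hK : ∀ M ∈ G, (M : Matrix (Fin n) (Fin n) ℝ) ∈ η.K) : AddSubgroup η.Alg where
  carrier := {x | ∃ M ∈ G, ((M ^ 2 : GL (Fin n) ℝ) : Matrix (Fin n) (Fin n) ℝ) =
    NormedSpace.exp (η.toMat x)}
  add_mem' := by
    rintro x y ⟨M, hM, hMx⟩ ⟨N, hN, hNy⟩
    refine ⟨M * N, G.mul_mem hM hN, ?_⟩
    have hc : Commute (η.toMat x) (η.toMat y) := by
      refine (Commute.map (η.commute_of_commute_expAlg (η.commute_of_toMat ?_)) η.toMat)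
      rw [← exp_toMat, ← hNy]
      exact (η.commute_toMat_of_sq_eq_exp hG hK hM (G.pow_mem hN 2) hMx).symm
    rw [map_add, Matrix.exp_add_of_commute _ _ hc, ← hMx, ← hNy, ← Units.val_mul,
      Commute.mul_pow (hG M hM N hN)]
  zero_mem' := ⟨1, G.one_mem, by simp⟩
  neg_mem' := by
    rintro x ⟨M, hM, hMx⟩
    refine ⟨M⁻¹, G.inv_mem hM, ?_⟩
    rw [map_neg, Matrix.exp_neg, ← hMx, inv_pow, Matrix.coe_units_inv]

variable (hG : ∀ X ∈ G, ∀ Y ∈ G, X * Y = Y * X)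
    (hK : ∀ M ∈ G, (M : Matrix (Fin n) (Fin n) ℝ) ∈ η.K)

theorem commute_of_mem_sqLog {x : η.Alg} (hx : x ∈ η.sqLog hG hK) {N : GL (Fin n) ℝ}
    (hN : N ∈ G) : Commute (N : Matrix (Fin n) (Fin n) ℝ) (η.toMat x) := by
  obtain ⟨M, hM, hMx⟩ := hx
  exact η.commute_toMat_of_sq_eq_exp hG hK hM hN hMx

theorem commute_toMat_of_mem_sqLog {x y : η.Alg} (hx : x ∈ η.sqLog hG hK)
    (hy : y ∈ η.sqLog hG hK) : Commute (η.toMat x) (η.toMat y) := by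
  obtain ⟨M, hM, hMy⟩ := hy
  refine (Commute.map (η.commute_of_commute_expAlg (η.commute_of_toMat ?_)) η.toMat)
  rw [← exp_toMat, ← hMy]
  exact (η.commute_of_mem_sqLog hG hK hx (G.pow_mem hM 2)).symm

theorem exp_toMat_eq_iff {x y : η.Alg} :
    NormedSpace.exp (η.toMat x) = NormedSpace.exp (η.toMat y) ↔ ∃ t, x = y + η.period t := by
  rw [exp_toMat, exp_toMat, η.toMat_injective.eq_iff, expAlg_eq_iff]

/-- As the b_k commute, every square is the exponential of an integer combination of them; any other
logarithm differs from it by a period. -/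
theorem mem_sqLog_iff {p : ℕ} {A : Fin p → GL (Fin n) ℝ}
    (hA : Subgroup.closure (Set.range A) = G) {b : Fin p → η.Alg}
    (hb : ∀ k, ((A k ^ 2 : GL (Fin n) ℝ) : Matrix (Fin n) (Fin n) ℝ) =
      NormedSpace.exp (η.toMat (b k))) {x : η.Alg} :
    x ∈ η.sqLog hG hK ↔
      ∃ (a : Fin p → ℤ) (t : Fin η.s → ℤ), x = ∑ k, a k • b k + η.period t := by
  have hbm : ∀ k, b k ∈ η.sqLog hG hK := fun k =>
    ⟨A k, hA ▸ Subgroup.subset_closure ⟨k, rfl⟩, hb k⟩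
  have hsum : ∀ a : Fin p → ℤ, ∑ k, a k • b k ∈ η.sqLog hG hK := fun a =>
    AddSubgroup.sum_mem _ fun k _ => AddSubgroup.zsmul_mem _ (hbm k) _
  constructor
  · rintro ⟨M, hM, hMx⟩
    have key : ∃ a : Fin p → ℤ, ((M ^ 2 : GL (Fin n) ℝ) : Matrix (Fin n) (Fin n) ℝ) =
        NormedSpace.exp (η.toMat (∑ k, a k • b k)) := by
      rw [← hA] at hM
      clear hMx
      induction hM using Subgroup.closure_induction with
      | mem M hM =>
        obtain ⟨k, rfl⟩ := hM
        refine ⟨Pi.single k 1, ?_⟩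
        rw [Finset.sum_eq_single k]
        · simpa using hb k
        · intro j _ hj
          simp [hj]
        · simp
      | one => exact ⟨0, by simp⟩
      | mul M N hM hN hM' hN' =>
        obtain ⟨a, ha⟩ := hM'
        obtain ⟨a', ha'⟩ := hN'
        refine ⟨a + a', ?_⟩
        simp only [Pi.add_apply, add_smul, Finset.sum_add_distrib]
        rw [map_add, Matrix.exp_add_of_commute _ _
          (η.commute_toMat_of_mem_sqLog hG hK (hsum a) (hsum a')), ← ha, ← ha', ← Units.val_mul,
          Commute.mul_pow (hG M (hA ▸ hM) N (hA ▸ hN))]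
      | inv M hM hM' =>
        obtain ⟨a, ha⟩ := hM'
        refine ⟨-a, ?_⟩
        simp only [Pi.neg_apply, neg_smul, Finset.sum_neg_distrib]
        rw [map_neg, Matrix.exp_neg, ← ha, inv_pow, Matrix.coe_units_inv]
    obtain ⟨a, ha⟩ := key
    exact ⟨a, η.exp_toMat_eq_iff.1 (hMx.symm.trans ha)⟩
  · rintro ⟨a, t, rfl⟩
    obtain ⟨M, hM, hMx⟩ := hsum a
    exact ⟨M, hM, hMx.trans (η.exp_toMat_eq_iff.2 ⟨t, rfl⟩).symm⟩

/-- The values at `u₀` of the logarithms of squares. -/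
def sqLogOrbit : Set (Fin n → ℝ) := {v | ∃ x ∈ η.sqLog hG hK, v = η.toMat x *ᵥ η.u₀}

theorem diag_eq_head (x : η.Alg) : η.diag x = η.head (η.toMat x *ᵥ η.u₀) := by
  rw [head_toMat_mulVec, head_u₀, mul_one]

/-- If the logarithms of the squares are dense, so is the orbit of `u₀` in the open set of
vectors with positive real first coordinates and nonzero complex first coordinates. -/
theorem mem_closure_orbit_of_pos (hd : Dense (η.sqLogOrbit hG hK)) {v : Fin n → ℝ}
    (h1 : ∀ k, 0 < (η.head v).1 k) (h2 : ∀ l, (η.head v).2 l ≠ 0) :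
    v ∈ closure (orbit G η.u₀) := by
  set T : Set (Matrix (Fin n) (Fin n) ℝ) := η.toMat '' (η.sqLog hG hK : Set η.Alg) with hT
  set S := Submodule.span ℝ T with hS
  have hcomm : ∀ X ∈ S, ∀ Y ∈ S, Commute X Y := fun X hX Y hY => by
    refine Matrix.commute_of_mem_span_of_mem_span ?_ hX hY
    rintro _ ⟨x, hx, rfl⟩ _ ⟨y, hy, rfl⟩
    exact η.commute_toMat_of_mem_sqLog hG hK hx hy
  have hSK : ∀ X ∈ S, ∃ x, η.toMat x = X := fun X hX => by
    have : S ≤ LinearMap.range η.toMat.toLinearMap := by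
      rw [hS, Submodule.span_le]
      rintro _ ⟨x, _, rfl⟩
      exact ⟨x, rfl⟩
    exact this hX
  have htop : S.map (Matrix.evalAt η.u₀) = ⊤ := by
    refine Matrix.map_evalAt_eq_top hd ?_
    rintro _ ⟨x, hx, rfl⟩
    exact ⟨_, Submodule.subset_span ⟨x, hx, rfl⟩, rfl⟩
  obtain ⟨ψ, hψS, hψu, hψ⟩ := Matrix.exists_evalAt_inverse S hcomm η.u₀ htop
  obtain ⟨y, hy⟩ := hSK _ (hψS v)
  have hyv : η.toMat y *ᵥ η.u₀ = v := by rw [hy, hψu]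
  have hyd : η.diag y = η.head v := by rw [diag_eq_head, hyv]
  obtain ⟨e, he⟩ := η.exists_exp_diag_eq h1 h2
  obtain ⟨x, hx, hxc⟩ := η.exists_expAlg_eq (hyd.trans he.symm)
  -- The logarithm x of y need not lie in S a priori, but it commutes with all that commutes with y,
  -- in particular with S, so ψ recovers it.
  have hψx : ψ (η.toMat x *ᵥ η.u₀) = η.toMat x := by
    refine hψ _ fun Z hZ => ?_
    obtain ⟨z, rfl⟩ := hSK Z hZ
    have : Commute z y := η.commute_of_toMat (hcomm _ hZ _ (hy ▸ hψS v))
    exact ((hxc z this).map η.toMat).symm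
  let F : (Fin n → ℝ) → (Fin n → ℝ) := fun w => Matrix.evalAt η.u₀ (NormedSpace.exp (ψ w))
  have hF : Continuous F := (Matrix.evalAt η.u₀).continuous_of_finiteDimensional.comp
    (Matrix.continuous_exp.comp ψ.continuous_of_finiteDimensional)
  have hFv : F (η.toMat x *ᵥ η.u₀) = v := by
    change NormedSpace.exp (ψ _) *ᵥ _ = v
    rw [hψx, exp_toMat, hx, hyv]
  -- So v = F(x u₀) is a limit of values of F at logarithms of squares, and these values are M² u₀.
  have h3 := hF.range_subset_closure_image_dense hd ⟨_, hFv⟩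
  refine closure_mono ?_ h3
  rintro _ ⟨_, ⟨c, hc, rfl⟩, rfl⟩
  obtain ⟨M, hM, hMc⟩ := hc
  refine ⟨M ^ 2, G.pow_mem hM 2, ?_⟩
  change NormedSpace.exp (ψ _) *ᵥ _ = _
  rw [hψ _ fun Z hZ => hcomm _ (Submodule.subset_span ⟨c, ⟨M, hM, hMc⟩, rfl⟩) _ hZ, hMc]

/-- For every `k`, some element of `G` has `k`-th real eigenvalue negative, the others positive. -/
def FlipsSigns (G : Subgroup (GL (Fin n) ℝ)) : Prop :=
  ∀ k, ∃ M ∈ G, η.eigen (M : Matrix (Fin n) (Fin n) ℝ) k < 0 ∧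
    ∀ i, i ≠ k → 0 < η.eigen (M : Matrix (Fin n) (Fin n) ℝ) i

theorem ind_eq_r_iff (G : Subgroup (GL (Fin n) ℝ)) : η.ind G = η.r ↔ η.FlipsSigns G := by
  rw [ind, FlipsSigns]
  conv_lhs => rhs; rw [← Fintype.card_fin η.r, ← Nat.card_eq_fintype_card, ← Set.ncard_univ]
  constructor
  · intro h k
    have := Set.eq_of_subset_of_ncard_le (Set.subset_univ _) h.ge
    have hk := Set.mem_univ k
    rw [← this] at hk
    exact hk
  · intro h
    congr 1
    exact Set.eq_univ_of_forall h

theorem eigen_mul (hK : ∀ M ∈ G, (M : Matrix (Fin n) (Fin n) ℝ) ∈ η.K)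
    {M N : GL (Fin n) ℝ} (hM : M ∈ G) (hN : N ∈ G) (k : Fin η.r) :
    η.eigen ((M * N : GL (Fin n) ℝ) : Matrix (Fin n) (Fin n) ℝ) k =
      η.eigen (M : Matrix (Fin n) (Fin n) ℝ) k * η.eigen (N : Matrix (Fin n) (Fin n) ℝ) k := by
  obtain ⟨x, hx⟩ := η.mem_K_iff.1 (hK M hM)
  obtain ⟨y, hy⟩ := η.mem_K_iff.1 (hK N hN)
  rw [Units.val_mul, ← hx, ← hy, ← map_mul, eigen_toMat, eigen_toMat, eigen_toMat, map_mul]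
  rfl

end BlockType
end AbelianLinear
end

/-! ### Dense orbits versus dense logarithms and sign changes. -/

noncomputable section

namespace AbelianLinear

namespace BlockType

variable {n : ℕ} (η : BlockType n) {G : Subgroup (GL (Fin n) ℝ)}
  (hG : ∀ X ∈ G, ∀ Y ∈ G, X * Y = Y * X)
  (hK : ∀ M ∈ G, (M : Matrix (Fin n) (Fin n) ℝ) ∈ η.K)

theorem exists_sign_pattern (hK : ∀ M ∈ G, (M : Matrix (Fin n) (Fin n) ℝ) ∈ η.K)
    (hf : η.FlipsSigns G) (s : Finset (Fin η.r)) :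
    ∃ M ∈ G, ∀ i, (i ∈ s → η.eigen (M : Matrix (Fin n) (Fin n) ℝ) i < 0) ∧
      (i ∉ s → 0 < η.eigen (M : Matrix (Fin n) (Fin n) ℝ) i) := by
  classical
  induction s using Finset.induction_on with
  | empty => exact ⟨1, G.one_mem, fun i => ⟨by simp, fun _ => by simp [eigen]⟩⟩
  | insert k s hk ih =>
    obtain ⟨M, hM, hMs⟩ := ih
    obtain ⟨N, hN, hNk, hNi⟩ := hf k
    refine ⟨N * M, G.mul_mem hN hM, fun i => ?_⟩
    rw [η.eigen_mul hK hN hM]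
    by_cases hik : i = k
    · subst hik
      exact ⟨fun _ => mul_neg_of_neg_of_pos hNk ((hMs i).2 hk),
        fun h => absurd (Finset.mem_insert_self _ _) h⟩
    · exact ⟨fun h => mul_neg_of_pos_of_neg (hNi i hik)
          ((hMs i).1 (Finset.mem_of_mem_insert_of_ne h hik)),
        fun h => mul_pos (hNi i hik) ((hMs i).2 fun h' => h (Finset.mem_insert_of_mem h'))⟩

theorem coe_mulVec_mem_orbit {M : GL (Fin n) ℝ} (hM : M ∈ G) {u v : Fin n → ℝ}
    (hv : v ∈ orbit G u) : (M : Matrix (Fin n) (Fin n) ℝ) *ᵥ v ∈ orbit G u := by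
  obtain ⟨N, hN, rfl⟩ := hv
  exact ⟨M * N, G.mul_mem hM hN, by rw [Matrix.mulVec_mulVec, Units.val_mul]⟩

theorem continuous_mulVec (M : Matrix (Fin n) (Fin n) ℝ) :
    Continuous fun v : Fin n → ℝ => M *ᵥ v :=
  M.mulVecLin.continuous_of_finiteDimensional

theorem coe_mulVec_mem_closure_orbit {M : GL (Fin n) ℝ} (hM : M ∈ G) {u v : Fin n → ℝ}
    (hv : v ∈ closure (orbit G u)) :
    (M : Matrix (Fin n) (Fin n) ℝ) *ᵥ v ∈ closure (orbit G u) :=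
  map_mem_closure (continuous_mulVec _) hv fun _ h => coe_mulVec_mem_orbit hM h

theorem head_ne_zero (v : Fin n → ℝ) (hv : ∀ i, v i ≠ 0) :
    (∀ k, (η.head v).1 k ≠ 0) ∧ ∀ l, (η.head v).2 l ≠ 0 :=
  ⟨fun _ => hv _, fun _ h => hv _ (congrArg Complex.re h)⟩

theorem dense_orbit_of_dense_sqLogOrbit (hd : Dense (η.sqLogOrbit hG hK))
    (hf : η.FlipsSigns G) : Dense (orbit G η.u₀) := by
  have h1 : Dense (Set.univ.pi fun _ : Fin n => ({0}ᶜ : Set ℝ)) :=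
    dense_pi _ fun _ _ => dense_compl_singleton 0
  rw [← dense_closure]
  refine h1.mono fun v hv => ?_
  have hv0 : ∀ i, v i ≠ 0 := fun i => hv i trivial
  obtain ⟨hv1, hv2⟩ := η.head_ne_zero v hv0
  -- M copies the signs of the real heads of v, so M v has positive real heads; M⁻¹ then brings it
  -- back.
  obtain ⟨M, hM, hMs⟩ := η.exists_sign_pattern hK hf
    (Finset.univ.filter fun k => (η.head v).1 k < 0)
  obtain ⟨x, hx⟩ := η.mem_K_iff.1 (hK M hM)
  obtain ⟨y, hy⟩ := η.mem_K_iff.1 (hK M⁻¹ (G.inv_mem hM))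
  have hxy : η.diag y * η.diag x = 1 := by
    rw [← map_mul, ← map_one η.diag]
    congr 1
    apply η.toMat_injective
    rw [map_mul, hx, hy, ← Units.val_mul, inv_mul_cancel, Units.val_one, map_one]
  have hhead : η.head ((M : Matrix (Fin n) (Fin n) ℝ) *ᵥ v) = η.diag x * η.head v := by
    rw [← hx, head_toMat_mulVec]
  have h2 : (M : Matrix (Fin n) (Fin n) ℝ) *ᵥ v ∈ closure (orbit G η.u₀) := by
    refine η.mem_closure_orbit_of_pos hG hK hd (fun k => ?_) fun l => ?_
    · rw [hhead]
      have h3 := hMs k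
      rw [← hx, eigen_toMat] at h3
      change 0 < (η.diag x).1 k * (η.head v).1 k
      rcases lt_or_gt_of_ne (hv1 k) with h | h
      · exact mul_pos_of_neg_of_neg (h3.1 (by simpa using h)) h
      · exact mul_pos (h3.2 (by simpa using h.le)) h
    · rw [hhead]
      change (η.diag x).2 l * (η.head v).2 l ≠ 0
      refine mul_ne_zero (fun h => ?_) (hv2 l)
      have h4 : (η.diag y).2 l * (η.diag x).2 l = 1 := congrFun (congrArg Prod.snd hxy) l
      rw [h, mul_zero] at h4
      exact zero_ne_one h4
  have h5 := coe_mulVec_mem_closure_orbit (G.inv_mem hM) h2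
  rwa [Matrix.mulVec_mulVec, ← Units.val_mul, inv_mul_cancel, Units.val_one,
    Matrix.one_mulVec] at h5

theorem isUnit_of_diag_mul_eq_one {y : η.Alg} {d : η.Diag} (h : η.diag y * d = 1) :
    IsUnit y := by
  have h1 : IsUnit (η.diag y) := IsUnit.of_mul_eq_one d h
  have h2 := (η.isNilpotent_sub_scalar_diag y).isUnit_add_left_of_commute (h1.map η.scalar)
    (η.commute_scalar _ _).symm
  rwa [add_sub_cancel] at h2

/-- The linear span of `G`. -/
def spanSubmodule (G : Subgroup (GL (Fin n) ℝ)) : Submodule ℝ (Matrix (Fin n) (Fin n) ℝ) :=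
  Submodule.span ℝ {X | ∃ M ∈ G, (M : Matrix (Fin n) (Fin n) ℝ) = X}

theorem coe_mem_spanSubmodule {M : GL (Fin n) ℝ} (hM : M ∈ G) :
    (M : Matrix (Fin n) (Fin n) ℝ) ∈ spanSubmodule G :=
  Submodule.subset_span ⟨M, hM, rfl⟩

theorem commute_spanSubmodule (hG : ∀ X ∈ G, ∀ Y ∈ G, X * Y = Y * X)
    {X Y : Matrix (Fin n) (Fin n) ℝ} (hX : X ∈ spanSubmodule G) (hY : Y ∈ spanSubmodule G) :
    Commute X Y := by
  refine Matrix.commute_of_mem_span_of_mem_span ?_ hX hY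
  rintro _ ⟨M, hM, rfl⟩ _ ⟨N, hN, rfl⟩
  exact commute_coe hG hM hN

theorem exists_toMat_of_mem_spanSubmodule
    (hK : ∀ M ∈ G, (M : Matrix (Fin n) (Fin n) ℝ) ∈ η.K) {X : Matrix (Fin n) (Fin n) ℝ}
    (hX : X ∈ spanSubmodule G) : ∃ x, η.toMat x = X := by
  have : spanSubmodule G ≤ LinearMap.range η.toMat.toLinearMap := by
    rw [spanSubmodule, Submodule.span_le]
    rintro _ ⟨M, hM, rfl⟩
    obtain ⟨x, hx⟩ := η.mem_K_iff.1 (hK M hM)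
    exact ⟨x, hx⟩
  exact this hX

theorem map_evalAt_spanSubmodule {v : Fin n → ℝ} (hd : Dense (orbit G v)) :
    (spanSubmodule G).map (Matrix.evalAt v) = ⊤ :=
  Matrix.map_evalAt_eq_top hd fun _ ⟨M, hM, h⟩ => ⟨M, coe_mem_spanSubmodule hM, h⟩

/-- Some Y in the span of `G` sends v to `u₀`. Its diagonal is invertible, so Y is; commuting with
`G`, it maps the orbit of v onto that of `u₀`. -/
theorem dense_orbit_u₀ (hG : ∀ X ∈ G, ∀ Y ∈ G, X * Y = Y * X)
    (hK : ∀ M ∈ G, (M : Matrix (Fin n) (Fin n) ℝ) ∈ η.K) {v : Fin n → ℝ}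
    (hd : Dense (orbit G v)) : Dense (orbit G η.u₀) := by
  have h1 : η.u₀ ∈ (spanSubmodule G).map (Matrix.evalAt v) :=
    map_evalAt_spanSubmodule hd ▸ trivial
  obtain ⟨Y, hY, hYv⟩ := h1
  obtain ⟨y, rfl⟩ := η.exists_toMat_of_mem_spanSubmodule hK hY
  rw [Matrix.evalAt_apply] at hYv
  have h2 : η.diag y * η.head v = 1 := by rw [← head_toMat_mulVec, hYv, head_u₀]
  obtain ⟨U, hU⟩ := (η.isUnit_of_diag_mul_eq_one h2).map η.toMat
  have hsurj : Function.Surjective fun w : Fin n → ℝ => η.toMat y *ᵥ w := fun w =>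
    ⟨((U⁻¹ : GL (Fin n) ℝ) : Matrix (Fin n) (Fin n) ℝ) *ᵥ w, by
      simp only [Matrix.mulVec_mulVec]
      rw [← hU, ← Units.val_mul, mul_inv_cancel, Units.val_one, Matrix.one_mulVec]⟩
  refine (hsurj.denseRange.dense_image (continuous_mulVec _) hd).mono ?_
  rintro _ ⟨_, ⟨M, hM, rfl⟩, rfl⟩
  refine ⟨M, hM, ?_⟩
  simp only [Matrix.mulVec_mulVec]
  rw [← hYv, Matrix.mulVec_mulVec,
    (commute_spanSubmodule hG hY (coe_mem_spanSubmodule hM)).eq]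

/-- The first coordinates of M u₀ are the eigenvalues of M, and a dense orbit meets every open sign
region. -/
theorem flipsSigns_of_dense_orbit (hK : ∀ M ∈ G, (M : Matrix (Fin n) (Fin n) ℝ) ∈ η.K)
    (hd : Dense (orbit G η.u₀)) : η.FlipsSigns G := by
  intro k
  have hopen : IsOpen (⋂ i : Fin η.r, {w : Fin n → ℝ |
      if i = k then w (η.firstCoord i) < 0 else 0 < w (η.firstCoord i)}) := by
    refine isOpen_iInter_of_finite fun i => ?_
    split_ifs
    · exact isOpen_lt (continuous_apply _) continuous_const
    · exact isOpen_lt continuous_const (continuous_apply _)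
  have hinj : ∀ i, η.firstCoord i = η.firstCoord k → i = k := fun i h => by
    have := η.coord.injective h
    rw [Sum.inl.injEq, Sigma.mk.injEq] at this
    exact this.1
  obtain ⟨_, ⟨M, hM, rfl⟩, hMk⟩ := hd.exists_mem_open hopen
    ⟨fun j => if j = η.firstCoord k then -1 else 1, by
      rw [Set.mem_iInter]
      intro i
      by_cases h : i = k
      · simp [h]
      · have : η.firstCoord i ≠ η.firstCoord k := fun h' => h (hinj i h')
        simp [h, this]⟩
  obtain ⟨x, hx⟩ := η.mem_K_iff.1 (hK M hM)
  rw [Set.mem_iInter] at hMk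
  have he : ∀ i, ((M : Matrix (Fin n) (Fin n) ℝ) *ᵥ η.u₀) (η.firstCoord i) =
      η.eigen (M : Matrix (Fin n) (Fin n) ℝ) i := fun i => by
    rw [← hx, eigen_toMat, diag_eq_head]
    rfl
  refine ⟨M, hM, ?_, fun i hi => ?_⟩
  · have := hMk k
    rw [Set.mem_ofPred_eq, if_pos rfl, he] at this
    exact this
  · have := hMk i
    rw [Set.mem_ofPred_eq, if_neg hi, he] at this
    exact this

open Filter Topology in
theorem dense_sqLogOrbit_of_dense_orbit (hd : Dense (orbit G η.u₀)) :
    Dense (η.sqLogOrbit hG hK) := by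
  obtain ⟨ψ, hψS, hψu, hψ⟩ := Matrix.exists_evalAt_inverse (spanSubmodule G)
    (fun X hX Y hY => commute_spanSubmodule hG hX hY) η.u₀ (map_evalAt_spanSubmodule hd)
  let E : (Fin n → ℝ) → (Fin n → ℝ) := fun w => Matrix.evalAt η.u₀ (NormedSpace.exp (ψ w))
  have hE : ∀ w, E w = NormedSpace.exp (ψ w) *ᵥ η.u₀ := fun w => rfl
  have hcexp : ∀ X ∈ spanSubmodule G, ∀ Y ∈ spanSubmodule G, Commute (NormedSpace.exp X) Y :=
    fun X hX Y hY => (commute_spanSubmodule hG hX hY).exp_left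
  -- The derivative of E at 0 is w ↦ ψ(w) u₀ = w, so the inverse function theorem applies; `hEadd`
  -- carries openness to every other point.
  have hE0 : map E (𝓝 0) = 𝓝 (E 0) := by
    have h1 := Matrix.hasStrictFDerivAt_exp_comp ψ (Matrix.evalAt η.u₀)
    have h2 : LinearMap.toContinuousLinearMap (Matrix.evalAt η.u₀ ∘ₗ ψ) =
        (ContinuousLinearEquiv.refl ℝ (Fin n → ℝ) : (Fin n → ℝ) →L[ℝ] (Fin n → ℝ)) := by
      ext1 v
      exact hψu v
    rw [h2] at h1
    exact h1.map_nhds_eq_of_equiv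
  have hEadd : ∀ v w, E (v + w) = NormedSpace.exp (ψ v) *ᵥ E w := fun v w => by
    rw [hE, hE, map_add, Matrix.exp_add_of_commute _ _
      (commute_spanSubmodule hG (hψS v) (hψS w)), Matrix.mulVec_mulVec]
  have hEnhds : ∀ v, ∀ W ∈ 𝓝 v, E '' W ∈ 𝓝 (E v) := fun v W hW => by
    have h1 : (fun w => v + w) ⁻¹' W ∈ 𝓝 (0 : Fin n → ℝ) :=
      (continuous_const.add continuous_id).continuousAt.preimage_mem_nhds (by simpa using hW)
    have h2 : E '' ((fun w => v + w) ⁻¹' W) ∈ 𝓝 (E 0) := hE0 ▸ image_mem_map h1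
    have hpos : NormedSpace.exp (ψ v) * NormedSpace.exp (ψ (-v)) = 1 := by
      rw [← Matrix.exp_add_of_commute _ _ (commute_spanSubmodule hG (hψS _) (hψS _)), ← map_add,
        add_neg_cancel, map_zero, NormedSpace.exp_zero]
    have h3 : (fun z => NormedSpace.exp (ψ (-v)) *ᵥ z) ⁻¹' (E '' ((fun w => v + w) ⁻¹' W)) ∈
        𝓝 (E v) := by
      refine (continuous_mulVec _).continuousAt.preimage_mem_nhds ?_
      rwa [← hEadd, neg_add_cancel]
    refine mem_of_superset h3 ?_
    rintro z ⟨w, hw, hwz⟩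
    refine ⟨v + w, hw, ?_⟩
    rw [hEadd, hwz, Matrix.mulVec_mulVec, hpos, Matrix.one_mulVec]
  let q : (Fin n → ℝ) → (Fin n → ℝ) := fun w => (ψ w) ^ 2 *ᵥ η.u₀
  have hq : Continuous q := (Matrix.evalAt η.u₀).continuous_of_finiteDimensional.comp
    (ψ.continuous_of_finiteDimensional.pow 2)
  -- E v is the value of q at exp(ψ(v/2)) u₀, and q sends M u₀ to M² u₀.
  have hEq : ∀ v, E v ∈ closure (q '' orbit G η.u₀) := fun v => by
    refine hq.range_subset_closure_image_dense hd
      ⟨NormedSpace.exp (ψ ((1 / 2 : ℝ) • v)) *ᵥ η.u₀, ?_⟩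
    change (ψ _) ^ 2 *ᵥ η.u₀ = _
    rw [hψ _ fun Y hY => hcexp _ (hψS _) Y hY, sq, ← Matrix.exp_add_of_commute _ _ (Commute.refl _),
      ← map_add, ← add_smul, hE]
    norm_num
  intro v
  rw [mem_closure_iff_nhds]
  intro W hW
  obtain ⟨z, ⟨w, hw, hwz⟩, _, ⟨M, hM, rfl⟩, hMz⟩ :=
    mem_closure_iff_nhds.1 (hEq v) _ (hEnhds v W hW)
  have hψM : ψ ((M : Matrix (Fin n) (Fin n) ℝ) *ᵥ η.u₀) = M :=
    hψ _ fun Y hY => commute_spanSubmodule hG (coe_mem_spanSubmodule hM) hY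
  -- Both matrices commute with the span of `G`, so equality at `u₀` forces equality: w is the value
  -- at `u₀` of a logarithm of M².
  have h1 : NormedSpace.exp (ψ w) *ᵥ η.u₀ = ((M ^ 2 : GL (Fin n) ℝ) : Matrix _ _ ℝ) *ᵥ η.u₀ := by
    rw [← hE, hwz, ← hMz]
    change (ψ _) ^ 2 *ᵥ η.u₀ = _
    rw [hψM, Units.val_pow_eq_pow_val]
  have h2 := congrArg ψ h1
  rw [hψ _ fun Y hY => hcexp _ (hψS _) Y hY,
    hψ _ fun Y hY => commute_spanSubmodule hG (coe_mem_spanSubmodule (G.pow_mem hM 2)) hY] at h2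
  obtain ⟨x, hx⟩ := η.exists_toMat_of_mem_spanSubmodule hK (hψS w)
  refine ⟨w, hw, x, ⟨M, hM, ?_⟩, ?_⟩
  · rw [hx, h2]
  · rw [hx, hψu]

end BlockType
end AbelianLinear
end

/-! ### The equivalences for subgroups of `K`. -/

noncomputable section

namespace AbelianLinear

namespace BlockType

variable {n : ℕ} (η : BlockType n) {G : Subgroup (GL (Fin n) ℝ)}
  (hG : ∀ X ∈ G, ∀ Y ∈ G, X * Y = Y * X)
  (hK : ∀ M ∈ G, (M : Matrix (Fin n) (Fin n) ℝ) ∈ η.K)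

theorem topTransitive_iff : TopTransitive G ↔ Dense (η.sqLogOrbit hG hK) ∧ η.ind G = η.r := by
  rw [ind_eq_r_iff]
  constructor
  · rintro ⟨v, hv⟩
    have h := η.dense_orbit_u₀ hG hK hv
    exact ⟨η.dense_sqLogOrbit_of_dense_orbit hG hK h, η.flipsSigns_of_dense_orbit hK h⟩
  · rintro ⟨h1, h2⟩
    exact ⟨_, η.dense_orbit_of_dense_sqLogOrbit hG hK h1 h2⟩

theorem sqLogOrbit_eq {p : ℕ} {A : Fin p → GL (Fin n) ℝ}
    (hA : Subgroup.closure (Set.range A) = G) {b : Fin p → η.Alg}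
    (hb : ∀ k, ((A k ^ 2 : GL (Fin n) ℝ) : Matrix (Fin n) (Fin n) ℝ) =
      NormedSpace.exp (η.toMat (b k))) :
    η.sqLogOrbit hG hK = {v | ∃ (a : Fin p → ℤ) (t : Fin η.s → ℤ),
      v = ∑ k, (a k : ℝ) • (η.toMat (b k) *ᵥ η.u₀) +
        ∑ l, (t l : ℝ) • ((2 * Real.pi) • η.f l)} := by
  have key : ∀ (a : Fin p → ℤ) (t : Fin η.s → ℤ),
      η.toMat (∑ k, a k • b k + η.period t) *ᵥ η.u₀ =
        ∑ k, (a k : ℝ) • (η.toMat (b k) *ᵥ η.u₀) +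
        ∑ l, (t l : ℝ) • ((2 * Real.pi) • η.f l) := fun a t => by
    rw [map_add, Matrix.add_mulVec, toMat_period_mulVec_u₀, map_sum, Matrix.sum_mulVec]
    congr 1
    · refine Finset.sum_congr rfl fun k _ => ?_
      rw [map_zsmul, ← Int.cast_smul_eq_zsmul ℝ, Matrix.smul_mulVec]
    · refine Finset.sum_congr rfl fun l _ => ?_
      rw [smul_smul, mul_comm]
  ext v
  constructor
  · rintro ⟨x, hx, rfl⟩
    obtain ⟨a, t, rfl⟩ := (η.mem_sqLog_iff hG hK hA hb).1 hx
    exact ⟨a, t, key a t⟩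
  · rintro ⟨a, t, rfl⟩
    exact ⟨_, (η.mem_sqLog_iff hG hK hA hb).2 ⟨a, t, rfl⟩, (key a t).symm⟩

theorem dense_sqLogOrbit_iff_rank {p : ℕ} [Nonempty (Fin p ⊕ Fin η.s)]
    {A : Fin p → GL (Fin n) ℝ}
    (hA : Subgroup.closure (Set.range A) = G) {b : Fin p → η.Alg}
    (hb : ∀ k, ((A k ^ 2 : GL (Fin n) ℝ) : Matrix (Fin n) (Fin n) ℝ) =
      NormedSpace.exp (η.toMat (b k))) :
    Dense (η.sqLogOrbit hG hK) ↔ ∀ (σ : Fin p → ℤ) (t : Fin η.s → ℤ), (σ, t) ≠ 0 →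
      (Matrix.fromBlocks
        (Matrix.of fun (i : Fin n) (k : Fin p) => (η.toMat (b k) *ᵥ η.u₀) i)
        (Matrix.of fun (i : Fin n) (l : Fin η.s) => 2 * Real.pi * η.f l i)
        (Matrix.of fun (_ : Unit) (k : Fin p) => (σ k : ℝ))
        (Matrix.of fun (_ : Unit) (l : Fin η.s) => (t l : ℝ))).rank = n + 1 := by
  rw [η.sqLogOrbit_eq hG hK hA hb]
  exact dense_int_span_iff_rank _ fun l => (2 * Real.pi) • η.f l

theorem densityProperty_and_ind_iff {p : ℕ} {A : Fin p → GL (Fin n) ℝ}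
    (hA : Subgroup.closure (Set.range A) = G) {b : Fin p → η.Alg}
    (hb : ∀ k, ((A k ^ 2 : GL (Fin n) ℝ) : Matrix (Fin n) (Fin n) ℝ) =
      NormedSpace.exp (η.toMat (b k))) :
    η.DensityProperty (fun k => (A k : Matrix (Fin n) (Fin n) ℝ)) ∧ η.ind G = η.r ↔
      Dense (η.sqLogOrbit hG hK) ∧ η.ind G = η.r := by
  refine and_congr_left fun hind => ?_
  -- With no columns the rank condition is vacuous. Then `G` is trivial, and maximal index forces r
  -- = 0, so n = 0 and density holds too.
  rcases isEmpty_or_nonempty (Fin p ⊕ Fin η.s) with he | hne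
  · rw [isEmpty_sum] at he
    obtain ⟨hp, hs⟩ := he
    have hGbot : G = ⊥ := by rw [← hA, Set.range_eq_empty, Subgroup.closure_empty]
    have hr : IsEmpty (Fin η.r) := ⟨fun k => by
      obtain ⟨M, hM, hneg, -⟩ := (η.ind_eq_r_iff G).1 hind k
      rw [hGbot, Subgroup.mem_bot] at hM
      subst hM
      simp [eigen] at hneg
      linarith⟩
    have hn : n = 0 := by
      rw [← η.sum_eq, Finset.univ_eq_empty, Finset.sum_empty, Finset.univ_eq_empty,
        Finset.sum_empty, mul_zero, add_zero]
    subst hn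
    refine iff_of_true ⟨fun k => η.toMat (b k), fun k => η.mem_K_iff.2 ⟨_, rfl⟩,
      fun k => by rw [← Units.val_pow_eq_pow_val, hb],
      fun σ t h => absurd (Subsingleton.elim _ _) h⟩ fun v => subset_closure ?_
    exact ⟨0, zero_mem _, Subsingleton.elim _ _⟩
  · constructor
    · rintro ⟨D, hDK, hD, hrank⟩
      choose d hd using fun k => η.mem_K_iff.1 (hDK k)
      obtain rfl : (fun k => η.toMat (d k)) = D := funext hd
      exact (η.dense_sqLogOrbit_iff_rank hG hK hA fun k => by
        rw [Units.val_pow_eq_pow_val]; exact hD k).2 hrank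
    · intro h
      exact ⟨fun k => η.toMat (b k), fun k => η.mem_K_iff.2 ⟨_, rfl⟩,
        fun k => by rw [← Units.val_pow_eq_pow_val, hb],
        (η.dense_sqLogOrbit_iff_rank hG hK hA hb).1 h⟩

end BlockType

/-! ### Transport by `P`, and the theorem. -/

section Conjugation

variable {n : ℕ} (P : GL (Fin n) ℝ)

theorem mem_conjInv {G : Subgroup (GL (Fin n) ℝ)} {M : GL (Fin n) ℝ} :
    M ∈ conjInv P G ↔ ∃ N ∈ G, P⁻¹ * N * P = M := by
  simp [conjInv, Subgroup.mem_map]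

theorem dense_image_mulVec_iff {D : Set (Fin n → ℝ)} :
    Dense ((fun v => (P : Matrix (Fin n) (Fin n) ℝ) *ᵥ v) '' D) ↔ Dense D := by
  let e : (Fin n → ℝ) ≃ₜ (Fin n → ℝ) :=
    { toFun := fun v => (P : Matrix (Fin n) (Fin n) ℝ) *ᵥ v
      invFun := fun v => ((P⁻¹ : GL (Fin n) ℝ) : Matrix (Fin n) (Fin n) ℝ) *ᵥ v
      left_inv := fun v => by
        simp only [Matrix.mulVec_mulVec]
        rw [← Units.val_mul, inv_mul_cancel, Units.val_one, Matrix.one_mulVec]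
      right_inv := fun v => by
        simp only [Matrix.mulVec_mulVec]
        rw [← Units.val_mul, mul_inv_cancel, Units.val_one, Matrix.one_mulVec]
      continuous_toFun := BlockType.continuous_mulVec _
      continuous_invFun := BlockType.continuous_mulVec _ }
  refine ⟨fun h => ?_, fun h => e.surjective.denseRange.dense_image e.continuous h⟩
  have h1 := e.symm.surjective.denseRange.dense_image e.symm.continuous h
  change Dense (e.symm '' (e '' D)) at h1
  simpa only [Set.image_image, e.symm_apply_apply, Set.image_id'] using h1

theorem orbit_mulVec (G : Subgroup (GL (Fin n) ℝ)) (v : Fin n → ℝ) :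
    orbit G ((P : Matrix (Fin n) (Fin n) ℝ) *ᵥ v) =
      (fun v => (P : Matrix (Fin n) (Fin n) ℝ) *ᵥ v) '' orbit (conjInv P G) v := by
  have key : ∀ N : GL (Fin n) ℝ, (N : Matrix (Fin n) (Fin n) ℝ) *ᵥ
      ((P : Matrix (Fin n) (Fin n) ℝ) *ᵥ v) = (P : Matrix (Fin n) (Fin n) ℝ) *ᵥ
        (((P⁻¹ * N * P : GL (Fin n) ℝ) : Matrix (Fin n) (Fin n) ℝ) *ᵥ v) := fun N => by
    simp only [Matrix.mulVec_mulVec]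
    rw [← Units.val_mul, ← Units.val_mul, mul_assoc, mul_inv_cancel_left]
  ext w
  constructor
  · rintro ⟨N, hN, rfl⟩
    exact ⟨_, ⟨_, (mem_conjInv P).2 ⟨N, hN, rfl⟩, rfl⟩, (key N).symm⟩
  · rintro ⟨_, ⟨_, hM, rfl⟩, rfl⟩
    obtain ⟨N, hN, rfl⟩ := (mem_conjInv P).1 hM
    exact ⟨N, hN, (key N).symm⟩

theorem topTransitive_conjInv_iff (G : Subgroup (GL (Fin n) ℝ)) :
    TopTransitive (conjInv P G) ↔ TopTransitive G := by
  constructor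
  · rintro ⟨v, hv⟩
    exact ⟨_, by rwa [orbit_mulVec P, dense_image_mulVec_iff]⟩
  · rintro ⟨v, hv⟩
    refine ⟨((P⁻¹ : GL (Fin n) ℝ) : Matrix (Fin n) (Fin n) ℝ) *ᵥ v, ?_⟩
    rwa [← dense_image_mulVec_iff P, ← orbit_mulVec, Matrix.mulVec_mulVec, ← Units.val_mul,
      mul_inv_cancel, Units.val_one, Matrix.one_mulVec]

theorem exp_conj_iff (M : GL (Fin n) ℝ) (C : Matrix (Fin n) (Fin n) ℝ) :
    NormedSpace.exp ((P : Matrix (Fin n) (Fin n) ℝ) * C * ((P⁻¹ : GL (Fin n) ℝ) :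
      Matrix (Fin n) (Fin n) ℝ)) = (M : Matrix (Fin n) (Fin n) ℝ) ↔
    ((P⁻¹ * M * P : GL (Fin n) ℝ) : Matrix (Fin n) (Fin n) ℝ) = NormedSpace.exp C := by
  have h1 : ((P⁻¹ : GL (Fin n) ℝ) : Matrix (Fin n) (Fin n) ℝ) * (P : Matrix (Fin n) (Fin n) ℝ) = 1 :=
    by rw [← Units.val_mul, inv_mul_cancel, Units.val_one]
  have h2 : (P : Matrix (Fin n) (Fin n) ℝ) * ((P⁻¹ : GL (Fin n) ℝ) : Matrix (Fin n) (Fin n) ℝ) = 1 :=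
    by rw [← Units.val_mul, mul_inv_cancel, Units.val_one]
  rw [Matrix.coe_units_inv, Matrix.exp_conj _ _ P.isUnit, ← Matrix.coe_units_inv, Units.val_mul,
    Units.val_mul]
  constructor
  · intro h
    rw [← h]
    simp only [mul_assoc, h1, mul_one]
    rw [← mul_assoc, h1, one_mul]
  · intro h
    rw [← h]
    simp only [mul_assoc, h2, mul_one]
    rw [← mul_assoc, h2, one_mul]

theorem conj_mulVec_mulVec (C : Matrix (Fin n) (Fin n) ℝ) (v : Fin n → ℝ) :
    ((P : Matrix (Fin n) (Fin n) ℝ) * C * ((P⁻¹ : GL (Fin n) ℝ) : Matrix (Fin n) (Fin n) ℝ)) *ᵥ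
      ((P : Matrix (Fin n) (Fin n) ℝ) *ᵥ v) = (P : Matrix (Fin n) (Fin n) ℝ) *ᵥ (C *ᵥ v) := by
  rw [Matrix.mulVec_mulVec, mul_assoc, ← Units.val_mul, inv_mul_cancel, Units.val_one, mul_one,
    Matrix.mulVec_mulVec]

variable (η : BlockType n) {G : Subgroup (GL (Fin n) ℝ)}

theorem image_logSet_squares (hG : ∀ X ∈ conjInv P G, ∀ Y ∈ conjInv P G, X * Y = Y * X)
    (hK : ∀ M ∈ conjInv P G, (M : Matrix (Fin n) (Fin n) ℝ) ∈ η.K) :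
    {x | ∃ C ∈ η.logSet P (squares G), x = C *ᵥ η.v₀ P} =
      (fun v => (P : Matrix (Fin n) (Fin n) ℝ) *ᵥ v) '' η.sqLogOrbit hG hK := by
  have hsq : ∀ N : GL (Fin n) ℝ, P⁻¹ * N ^ 2 * P = (P⁻¹ * N * P) ^ 2 := fun N => by
    rw [sq, sq]; group
  ext x
  constructor
  · rintro ⟨_, ⟨⟨_, ⟨N, hN, rfl⟩, hNe⟩, C, hC, rfl⟩, rfl⟩
    obtain ⟨c, rfl⟩ := η.mem_K_iff.1 hC
    rw [exp_conj_iff, hsq] at hNe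
    exact ⟨_, ⟨c, ⟨_, (mem_conjInv P).2 ⟨N, hN, rfl⟩, hNe⟩, rfl⟩, (conj_mulVec_mulVec P _ _).symm⟩
  · rintro ⟨_, ⟨c, ⟨M, hM, hMc⟩, rfl⟩, rfl⟩
    obtain ⟨N, hN, rfl⟩ := (mem_conjInv P).1 hM
    rw [← hsq, ← exp_conj_iff] at hMc
    exact ⟨_, ⟨⟨_, ⟨N, hN, rfl⟩, hMc⟩, _, η.mem_K_iff.2 ⟨c, rfl⟩, rfl⟩,
      (conj_mulVec_mulVec P _ _).symm⟩

theorem lattice_eq_image {p : ℕ} (b : Fin p → Matrix (Fin n) (Fin n) ℝ) :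
    η.lattice P (fun k => (P : Matrix (Fin n) (Fin n) ℝ) * b k * ((P⁻¹ : GL (Fin n) ℝ) :
      Matrix (Fin n) (Fin n) ℝ)) =
      (fun v => (P : Matrix (Fin n) (Fin n) ℝ) *ᵥ v) '' {v | ∃ (a : Fin p → ℤ) (t : Fin η.s → ℤ),
      v = ∑ k, (a k : ℝ) • (b k *ᵥ η.u₀) + ∑ l, (t l : ℝ) • ((2 * Real.pi) • η.f l)} := by
  have key : ∀ (a : Fin p → ℤ) (t : Fin η.s → ℤ), (P : Matrix (Fin n) (Fin n) ℝ) *ᵥ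
      (∑ k, (a k : ℝ) • (b k *ᵥ η.u₀) + ∑ l, (t l : ℝ) • ((2 * Real.pi) • η.f l)) =
      ∑ k, (a k : ℝ) • (((P : Matrix (Fin n) (Fin n) ℝ) * b k * ((P⁻¹ : GL (Fin n) ℝ) :
        Matrix (Fin n) (Fin n) ℝ)) *ᵥ η.v₀ P) +
      ∑ l, (2 * Real.pi * (t l : ℝ)) • ((P : Matrix (Fin n) (Fin n) ℝ) *ᵥ η.f l) := fun a t => by
    rw [Matrix.mulVec_add, Matrix.mulVec_sum, Matrix.mulVec_sum]
    congr 1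
    · refine Finset.sum_congr rfl fun k _ => ?_
      rw [BlockType.v₀, conj_mulVec_mulVec, Matrix.mulVec_smul]
    · refine Finset.sum_congr rfl fun l _ => ?_
      rw [Matrix.mulVec_smul, Matrix.mulVec_smul, smul_smul, mul_comm]
  ext x
  constructor
  · rintro ⟨a, t, rfl⟩
    exact ⟨_, ⟨a, t, rfl⟩, key a t⟩
  · rintro ⟨_, ⟨a, t, rfl⟩, rfl⟩
    exact ⟨a, t, key a t⟩

end Conjugation

end AbelianLinear
end

theorem corollary1p5 {n : ℕ} (η : AbelianLinear.BlockType n)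
    (G : Subgroup (GL (Fin n) ℝ))
    (hG : ∀ X ∈ G, ∀ Y ∈ G, X * Y = Y * X)
    (P : GL (Fin n) ℝ)
    (hP : ∀ M ∈ AbelianLinear.conjInv P G, (M : Matrix (Fin n) (Fin n) ℝ) ∈ η.K)
    {p : ℕ} (A : Fin p → GL (Fin n) ℝ)
    (hA : Subgroup.closure (Set.range A) = G)
    (B : Fin p → Matrix (Fin n) (Fin n) ℝ)
    (hB : ∀ k, B k ∈ η.logSet P (G : Set (GL (Fin n) ℝ)))
    (hAB : ∀ k, (A k : Matrix (Fin n) (Fin n) ℝ) ^ 2 = NormedSpace.exp (B k)) :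
    {x | ∃ C ∈ η.logSet P (AbelianLinear.squares G), x = C *ᵥ η.v₀ P} = η.lattice P B ∧
    List.TFAE
      [AbelianLinear.TopTransitive G,
       η.DensityProperty
          (fun k => ((P⁻¹ * A k * P : GL (Fin n) ℝ) : Matrix (Fin n) (Fin n) ℝ)) ∧
        η.ind (AbelianLinear.conjInv P G) = η.r,
       Dense (η.lattice P B) ∧ η.ind (AbelianLinear.conjInv P G) = η.r] := by
  have hG' : ∀ X ∈ AbelianLinear.conjInv P G, ∀ Y ∈ AbelianLinear.conjInv P G,
      X * Y = Y * X := by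
    intro X hX Y hY
    obtain ⟨M, hM, rfl⟩ := (AbelianLinear.mem_conjInv P).1 hX
    obtain ⟨N, hN, rfl⟩ := (AbelianLinear.mem_conjInv P).1 hY
    have h := hG M hM N hN
    calc P⁻¹ * M * P * (P⁻¹ * N * P) = P⁻¹ * (M * N) * P := by group
      _ = P⁻¹ * N * P * (P⁻¹ * M * P) := by rw [h]; group
  have hA' : Subgroup.closure (Set.range fun k => P⁻¹ * A k * P) =
      AbelianLinear.conjInv P G := by
    rw [AbelianLinear.conjInv, ← hA, MonoidHom.map_closure, ← Set.range_comp]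
    congr 2
  choose _ C hCK hBC using fun k => (hB k)
  choose b hb using fun k => η.mem_K_iff.1 (hCK k)
  obtain rfl : (fun k => η.toMat (b k)) = C := funext hb
  obtain rfl : B = fun k => (P : Matrix (Fin n) (Fin n) ℝ) * η.toMat (b k) *
      ((P⁻¹ : GL (Fin n) ℝ) : Matrix (Fin n) (Fin n) ℝ) := funext hBC
  have hb2 : ∀ k, (((P⁻¹ * A k * P) ^ 2 : GL (Fin n) ℝ) : Matrix (Fin n) (Fin n) ℝ) =
      NormedSpace.exp (η.toMat (b k)) := fun k => by
    have h1 : (P⁻¹ * A k * P) ^ 2 = P⁻¹ * A k ^ 2 * P := by rw [sq, sq]; group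
    rw [h1, ← AbelianLinear.exp_conj_iff, Units.val_pow_eq_pow_val]
    exact (hAB k).symm
  have hlat := AbelianLinear.lattice_eq_image P η fun k => η.toMat (b k)
  rw [← η.sqLogOrbit_eq hG' hP hA' hb2] at hlat
  refine ⟨(AbelianLinear.image_logSet_squares P η hG' hP).trans hlat.symm, ?_⟩
  rw [hlat, AbelianLinear.dense_image_mulVec_iff, ← AbelianLinear.topTransitive_conjInv_iff P,
    η.topTransitive_iff hG' hP, η.densityProperty_and_ind_iff hG' hP hA' hb2]
  -- The rewriting has turned all three statements into density of `sqLogOrbit` together with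
  -- maximal index.
  tfae_have 1 ↔ 2 := Iff.rfl
  tfae_have 2 ↔ 3 := Iff.rfl
  tfae_finish
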